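/- Let $0<\alpha\le 2$. For $n\in\mathbb N_0$ let $P_n=P_n^{(\alpha/2)}$ be the Jacobi polynomial $P_n^{(\alpha/2,\alpha/2)}$ normalized by $P_n(1)=1$; that is, $P_n$ is a polynomial of degree $n$, $P_n(1)=1$, and $\int_{-1}^1(1-x^2)^{\alpha/2}P_m(x)P_n(x)\,dx=0$ for $m\neq n$. Let $\rho>1$ and let $q$ be analytic at every point inside and on the Bernstein ellipse $$\mathcal E_\rho=\left\{\tfrac12\left(\rho e^{i\theta}+\rho^{-1}e^{-i\theta}\right) : 0\le\theta\le 2\pi\right\}\subset\mathbb C .$$ For $m,n\in\mathbb N_0$ put $$q_{mn}=\int_{-1}^1(1-x^2)^{\alpha}\,q(x)\,P_m(x)\,P_n(x)\,dx .$$ Then $q_{mn}=O\left((m+n)^{-\alpha-1}\,|m-n|^{-\alpha-1}\right)$ for $m\neq n$ and $m+n$ large, that is, there are constants $K$ and $N$ (which may depend on $\alpha$, $\rho$ and $q$) such that $$|q_{mn}|\le K\,(m+n)^{-\alpha-1}\,|m-n|^{-\alpha-1}\qquad\text{for all } m\neq n \text{ with } m+n\ge N .$$ -/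

import Mathlib

open MeasureTheory Polynomial

/-- The inner product `⟨p, r⟩_β = ∫_{-1}^1 (1 - x²)^β p(x) r(x) dx` on real polynomials. -/
noncomputable def ultraInner (β : ℝ) (p r : ℝ[X]) : ℝ :=
  ∫ x in (-1 : ℝ)..1, (1 - x ^ 2) ^ β * (p.eval x * r.eval x)

/-- The monic orthogonal polynomials for the weight `(1 - x²)^β` on `(-1, 1)`, obtained by
orthogonalizing `1, X, X², …`. -/
noncomputable def monicOrtho (β : ℝ) : ℕ → ℝ[X]
  | n => X ^ n - ∑ k : Fin n,
      C (ultraInner β (X ^ n) (monicOrtho β k) /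
        ultraInner β (monicOrtho β k) (monicOrtho β k)) * monicOrtho β k
  decreasing_by all_goals exact k.2

/-- The Jacobi polynomial `P_n^{(β)} = P_n^{(β,β)}`, with the normalization `P_n^{(β)}(1) = 1`:
the orthogonal polynomial of degree `n` for the weight `(1 - x²)^β` on `(-1, 1)` with value `1`
at `1`. (The theorem `jacobiP_spec` below shows that it has these properties.) -/
noncomputable def jacobiP (β : ℝ) (n : ℕ) : ℝ[X] :=
  C (((monicOrtho β n).eval 1)⁻¹) * monicOrtho β n

section Facts

theorem ultraInner_continuous {β : ℝ} (hβ : 0 ≤ β) (p r : ℝ[X]) :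
    Continuous fun x : ℝ => (1 - x ^ 2) ^ β * (p.eval x * r.eval x) := by
  refine Continuous.mul (Continuous.rpow_const (by fun_prop) fun _ => Or.inr hβ) ?_
  exact p.continuous.mul r.continuous

theorem ultraInner_comm (β : ℝ) (p r : ℝ[X]) : ultraInner β p r = ultraInner β r p := by
  unfold ultraInner
  simp only [mul_comm (p.eval _)]

theorem ultraInner_sub_left {β : ℝ} (hβ : 0 ≤ β) (p r s : ℝ[X]) :
    ultraInner β (p - r) s = ultraInner β p s - ultraInner β r s := by
  unfold ultraInner
  rw [← intervalIntegral.integral_sub ((ultraInner_continuous hβ p s).intervalIntegrable _ _)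
    ((ultraInner_continuous hβ r s).intervalIntegrable _ _)]
  congr 1
  ext x
  simp only [eval_sub]
  ring

theorem ultraInner_C_mul_left (β c : ℝ) (p r : ℝ[X]) :
    ultraInner β (C c * p) r = c * ultraInner β p r := by
  unfold ultraInner
  rw [← intervalIntegral.integral_const_mul]
  congr 1
  ext x
  simp only [eval_mul, eval_C]
  ring

theorem ultraInner_sum_left {β : ℝ} (hβ : 0 ≤ β) {ι : Type*} (s : Finset ι) (f : ι → ℝ[X])
    (r : ℝ[X]) : ultraInner β (∑ i ∈ s, f i) r = ∑ i ∈ s, ultraInner β (f i) r := by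
  unfold ultraInner
  rw [← intervalIntegral.integral_finsetSum
    fun i _ => (ultraInner_continuous hβ (f i) r).intervalIntegrable _ _]
  congr 1
  ext x
  rw [eval_finsetSum, Finset.sum_mul, Finset.mul_sum]

/-- A continuous weight that is positive on the open interval gives a definite form. -/
theorem weighted_integral_pos {w : ℝ → ℝ} (hw : Continuous w)
    (hpos : ∀ x ∈ Set.Ioo (-1 : ℝ) 1, 0 < w x)
    (hnn : ∀ x ∈ Set.Icc (-1 : ℝ) 1, 0 ≤ w x) {p : ℝ[X]} (hp : p ≠ 0) :
    0 < ∫ x in (-1 : ℝ)..1, w x * (p.eval x * p.eval x) := by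
  have hfin : {x | p.IsRoot x}.Finite := Polynomial.finite_setOfPred_isRoot hp
  obtain ⟨c, hc, hc'⟩ := ((Set.Ioo_infinite (show (-1 : ℝ) < 1 by norm_num)).sdiff hfin).nonempty
  refine intervalIntegral.integral_pos (by norm_num) ?_ ?_ ⟨c, ⟨hc.1.le, hc.2.le⟩, ?_⟩
  · exact (hw.mul (p.continuous.mul p.continuous)).continuousOn
  · exact fun x hx => mul_nonneg (hnn x ⟨hx.1.le, hx.2⟩) (mul_self_nonneg _)
  · exact mul_pos (hpos c hc) (mul_self_pos.2 hc')

theorem ultraInner_self_pos {β : ℝ} (hβ : 0 ≤ β) {p : ℝ[X]} (hp : p ≠ 0) :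
    0 < ultraInner β p p := by
  refine weighted_integral_pos (w := fun x => (1 - x ^ 2) ^ β) ?_ ?_ ?_ hp
  · exact Continuous.rpow_const (by fun_prop) fun _ => Or.inr hβ
  · exact fun x hx => Real.rpow_pos_of_pos (by nlinarith [hx.1, hx.2]) _
  · exact fun x hx => Real.rpow_nonneg (by nlinarith [hx.1, hx.2]) _

theorem monicOrtho_degree (β : ℝ) (n : ℕ) :
    (monicOrtho β n).Monic ∧ (monicOrtho β n).degree = n := by
  induction n using Nat.strong_induction_on with
  | _ n ih =>
    have hlt : (∑ k : Fin n, C (ultraInner β (X ^ n) (monicOrtho β k) /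
        ultraInner β (monicOrtho β k) (monicOrtho β k)) * monicOrtho β k).degree
          < (X ^ n : ℝ[X]).degree := by
      rw [degree_X_pow]
      refine (degree_sum_le _ _).trans_lt ?_
      refine (Finset.sup_lt_iff (WithBot.bot_lt_coe n)).2 ?_
      intro k _
      rw [← smul_eq_C_mul]
      refine (degree_smul_le _ _).trans_lt ?_
      rw [(ih k k.2).2]
      exact WithBot.coe_lt_coe.2 k.2
    rw [monicOrtho]
    refine ⟨(monic_X_pow n).sub_of_left hlt, ?_⟩
    rw [degree_sub_eq_left_of_degree_lt hlt, degree_X_pow]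

theorem monicOrtho_orthogonal {β : ℝ} (hβ : 0 ≤ β) {m n : ℕ} (hmn : m < n) :
    ultraInner β (monicOrtho β n) (monicOrtho β m) = 0 := by
  induction n using Nat.strong_induction_on generalizing m with
  | _ n ih =>
    have hself := (ultraInner_self_pos hβ (monicOrtho_degree β m).1.ne_zero).ne'
    rw [monicOrtho, ultraInner_sub_left hβ, ultraInner_sum_left hβ,
      Finset.sum_eq_single (⟨m, hmn⟩ : Fin n)]
    · rw [ultraInner_C_mul_left]
      field_simp
      ring
    · intro k _ hk
      have hk' : (k : ℕ) ≠ m := fun h => hk (Fin.ext h)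
      rw [ultraInner_C_mul_left]
      rcases lt_or_gt_of_ne hk' with h | h
      · rw [ultraInner_comm β (monicOrtho β k) (monicOrtho β m), ih m hmn h, mul_zero]
      · rw [ih k k.2 h, mul_zero]
    · simp

theorem monicOrtho_orthogonal_of_degree_lt {β : ℝ} (hβ : 0 ≤ β) (n : ℕ) (r : ℝ[X])
    (hr : r.degree < n) : ultraInner β r (monicOrtho β n) = 0 := by
  suffices H : ∀ k ≤ n, ∀ r : ℝ[X], r.degree < k → ultraInner β r (monicOrtho β n) = 0 from
    H n le_rfl r hr
  intro k
  induction k with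
  | zero =>
    intro _ r hr
    have : r = 0 := by
      rw [← degree_eq_bot]
      exact Nat.WithBot.lt_zero_iff.1 (by exact_mod_cast hr)
    simp [this, ultraInner]
  | succ k ih =>
    intro hk r hr
    have hred : (r - C (r.coeff k) * monicOrtho β k).degree < k := by
      rw [degree_lt_iff_coeff_zero]
      intro j hj
      obtain ⟨hm, hd⟩ := monicOrtho_degree β k
      rcases hj.eq_or_lt with rfl | hj
      · have : (monicOrtho β k).coeff k = 1 := by
          have := hm.coeff_natDegree
          rwa [natDegree_eq_of_degree_eq_some hd] at this
        simp [this]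
      · rw [coeff_sub, coeff_C_mul, coeff_eq_zero_of_degree_lt (n := j) (p := r),
          coeff_eq_zero_of_degree_lt (n := j) (p := monicOrtho β k)]
        · simp
        · rw [hd]
          exact_mod_cast hj
        · exact hr.trans_le (by exact_mod_cast hj)
    have h := ih (by omega) _ hred
    rw [ultraInner_sub_left hβ, ultraInner_C_mul_left, ultraInner_comm β (monicOrtho β k),
      monicOrtho_orthogonal hβ (by omega : k < n), mul_zero, sub_zero] at h
    exact h

theorem monicOrtho_eval_one_ne_zero {β : ℝ} (hβ : 0 ≤ β) (n : ℕ) :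
    (monicOrtho β n).eval 1 ≠ 0 := by
  intro h0
  obtain ⟨r, hr⟩ := dvd_iff_isRoot.2 (show (monicOrtho β n).IsRoot 1 from h0)
  obtain ⟨hm, hd⟩ := monicOrtho_degree β n
  have hr0 : r ≠ 0 := by
    rintro rfl
    exact hm.ne_zero (by simpa using hr)
  have hdr : r.degree < n := by
    rw [← hd, hr, degree_mul, degree_X_sub_C, degree_eq_natDegree hr0]
    exact_mod_cast (by omega : r.natDegree < 1 + r.natDegree)
  have horth := monicOrtho_orthogonal_of_degree_lt hβ n r hdr
  have hp := weighted_integral_pos (w := fun x => (1 - x ^ 2) ^ β * (1 - x)) (p := r)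
    (Continuous.mul (Continuous.rpow_const (by fun_prop) fun _ => Or.inr hβ) (by fun_prop))
    (fun x hx => mul_pos (Real.rpow_pos_of_pos (by nlinarith [hx.1, hx.2]) _)
      (by linarith [hx.2]))
    (fun x hx => mul_nonneg (Real.rpow_nonneg (by nlinarith [hx.1, hx.2]) _)
      (by linarith [hx.2])) hr0
  have hneg : ultraInner β r (monicOrtho β n) =
      -∫ x in (-1 : ℝ)..1, (1 - x ^ 2) ^ β * (1 - x) * (r.eval x * r.eval x) := by
    rw [ultraInner, ← intervalIntegral.integral_neg, hr]
    congr 1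
    ext x
    simp only [eval_mul, eval_sub, eval_X, eval_C]
    ring
  linarith

/-- The defining properties of the Jacobi polynomials `P_n^{(β)}`. -/
theorem jacobiP_spec {β : ℝ} (hβ : 0 ≤ β) :
    (∀ n, (jacobiP β n).natDegree = n) ∧ (∀ n, (jacobiP β n).eval 1 = 1) ∧
      ∀ m n, m ≠ n → ultraInner β (jacobiP β m) (jacobiP β n) = 0 := by
  refine ⟨fun n => ?_, fun n => ?_, fun m n hmn => ?_⟩
  · rw [jacobiP, natDegree_C_mul (inv_ne_zero (monicOrtho_eval_one_ne_zero hβ n)),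
      natDegree_eq_of_degree_eq_some (monicOrtho_degree β n).2]
  · rw [jacobiP, eval_mul, eval_C, inv_mul_cancel₀ (monicOrtho_eval_one_ne_zero hβ n)]
  · rw [jacobiP, jacobiP, ultraInner_C_mul_left, ultraInner_comm, ultraInner_C_mul_left]
    rcases lt_or_gt_of_ne hmn with h | h
    · rw [monicOrtho_orthogonal hβ h, mul_zero, mul_zero]
    · rw [ultraInner_comm, monicOrtho_orthogonal hβ h, mul_zero, mul_zero]

end Facts

/-- The Bernstein ellipse `E_ρ`, the set of the points `(ρ e^{iθ} + ρ⁻¹ e^{-iθ}) / 2`. -/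
noncomputable def bernsteinEllipse (ρ : ℝ) : Set ℂ :=
  {z | ∃ θ ∈ Set.Icc (0 : ℝ) (2 * Real.pi),
    z = 1 / 2 * ((ρ : ℂ) * Complex.exp (θ * Complex.I) +
      (ρ : ℂ)⁻¹ * Complex.exp (-(θ * Complex.I)))}

/-- The points inside and on the Bernstein ellipse `E_ρ`: the filled ellipse, which is the
convex hull of the curve. -/
noncomputable def bernsteinRegion (ρ : ℝ) : Set ℂ :=
  convexHull ℝ (bernsteinEllipse ρ)

/-- The entries `q_{mn} = ∫_{-1}^1 (1 - x²)^α q(x) P_m^{(α/2)}(x) P_n^{(α/2)}(x) dx`. -/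
noncomputable def potentialEntry (α : ℝ) (q : ℂ → ℂ) (m n : ℕ) : ℂ :=
  ∫ x in (-1 : ℝ)..1, (((1 - x ^ 2) ^ α : ℝ) : ℂ) * q x *
    (((jacobiP (α / 2) m).eval x : ℝ) : ℂ) * (((jacobiP (α / 2) n).eval x : ℝ) : ℂ)

/-!
Put `l = (α + 1) / 2`, so that `α / 2 = l - 1 / 2` and the Jacobi polynomials `P_n^{(α/2)}` are the
Gegenbauer polynomials of parameter `l` divided by their values at `1`. These are the polynomials
`R_n = gegen l n` of the three-term recurrence (`jacobiP_eq_gegen`). The claimed bound is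
`q_{mn} = O((m + n)^(-2l) |m - n|^(-2l))`.

The product `R_m R_n` is a convex combination `∑ g_j R_{m+n-2j}` with explicit coefficients, by
Dougall's linearization formula (`gegen_mul_gegen`). Hence `q_{mn}` is the same average of the
moments `∫ (1 - x²)^α q R_k`, where `k` runs from `|m - n|` to `m + n` in steps of two
(`potentialEntry_eq_sum`), and two facts suffice.

The moments are `O(k^(-4l))` (`hasMomentDecay_of_differentiableOn`). For `q = 1` they satisfy a
two-term recurrence, and this carries over to polynomials `q` because `x R_k` is a convex
combination of `R_{k+1}` and `R_{k-1}`. A general `q` differs from a polynomial by `(1 - z²)³ r`, for which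
three applications of the differential equation give `O(k⁻⁶)`, and `4l ≤ 6`.

The average of `k^(-4l)` is `O((m + n)^(-2l) |m - n|^(-2l))` (`sum_linCoeff_mul_rpow_le`). Indices
`k ≥ (m + n) / 3` are covered by `k ≥ |m - n|` and `∑ g_j = 1`. For the others, power bounds for
the Pochhammer symbols in Dougall's formula make `g_j` small enough (`dougall_le`), and the
remaining sum is compared with a telescoping one (`sum_rpow_mul_rpow_le`).
-/

/-! ### Gegenbauer polynomials -/

/-- The Gegenbauer polynomial `C_n^{(l)}` divided by its value at `1`, through its three-term
recurrence. -/
noncomputable def gegen (l : ℝ) : ℕ → ℝ[X]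
  | 0 => 1
  | 1 => X
  | n + 2 => C (2 * (n + 1 + l) / (n + 1 + 2 * l)) * (X * gegen l (n + 1)) -
      C ((n + 1) / (n + 1 + 2 * l)) * gegen l n

theorem gegen_rec {l : ℝ} (hl : 0 < l) (n : ℕ) :
    C ((n : ℝ) + 1 + 2 * l) * gegen l (n + 2) =
      C (2 * (n + 1 + l)) * (X * gegen l (n + 1)) - C ((n : ℝ) + 1) * gegen l n := by
  have h : (n : ℝ) + 1 + 2 * l ≠ 0 := by positivity
  simp only [gegen, mul_sub, ← mul_assoc, ← C_mul, mul_div_cancel₀ _ h]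

theorem gegen_eval_rec {l : ℝ} (hl : 0 < l) (n : ℕ) (x : ℝ) :
    (n + 1 + 2 * l) * (gegen l (n + 2)).eval x =
      2 * (n + 1 + l) * (x * (gegen l (n + 1)).eval x) - (n + 1) * (gegen l n).eval x := by
  simpa using congrArg (eval x) (gegen_rec hl n)

theorem gegen_eval_one {l : ℝ} (hl : 0 < l) (n : ℕ) : (gegen l n).eval 1 = 1 := by
  induction n using Nat.twoStepInduction with
  | zero => simp [gegen]
  | one => simp [gegen]
  | more n h0 h1 =>
    have h := gegen_eval_rec hl n 1
    rw [h0, h1] at h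
    have h' : (n : ℝ) + 1 + 2 * l ≠ 0 := by positivity
    exact mul_left_cancel₀ h' (by linarith)

theorem gegen_natDegree_le (l : ℝ) (n : ℕ) : (gegen l n).natDegree ≤ n := by
  induction n using Nat.twoStepInduction with
  | zero => simp [gegen]
  | one => simp [gegen]
  | more n h0 h1 =>
    rw [gegen]
    refine (natDegree_sub_le _ _).trans (max_le ?_ ?_)
    · refine (natDegree_C_mul_le _ _).trans (natDegree_mul_le.trans ?_)
      rw [natDegree_X]
      omega
    · exact (natDegree_C_mul_le _ _).trans (by omega)

/-- The two first-order relations expressing `(1 - x²) R_n'` through neighbouring polynomials. -/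
theorem gegen_derivative {l : ℝ} (hl : 0 < l) (n : ℕ) (x : ℝ) :
    (1 - x ^ 2) * (derivative (gegen l n)).eval x =
        (n + 2 * l) * (x * (gegen l n).eval x - (gegen l (n + 1)).eval x) ∧
      (1 - x ^ 2) * (derivative (gegen l (n + 1))).eval x =
        (n + 1) * ((gegen l n).eval x - x * (gegen l (n + 1)).eval x) := by
  induction n with
  | zero => simp [gegen]; ring
  | succ n ih =>
    obtain ⟨hA, hB⟩ := ih
    have hr := gegen_eval_rec hl n x
    have hd := congrArg (fun p => eval x (derivative p)) (gegen_rec hl n)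
    simp only [derivative_mul, derivative_C, derivative_sub, derivative_X, eval_add, eval_mul,
      eval_sub, eval_C, eval_X, zero_mul, zero_add, one_mul] at hd
    have h' : (n : ℝ) + 1 + 2 * l ≠ 0 := by positivity
    push_cast
    refine ⟨by linear_combination hB + hr, mul_left_cancel₀ h' ?_⟩
    linear_combination (1 - x ^ 2) * hd - (n + 1) * hA + 2 * (n + 1 + l) * x * hB +
      (n + 2) * x * hr

/-- The Gegenbauer differential equation. -/
theorem gegen_ode {l : ℝ} (hl : 0 < l) (n : ℕ) (x : ℝ) :
    (1 - x ^ 2) * (derivative (derivative (gegen l n))).eval x =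
      (2 * l + 1) * x * (derivative (gegen l n)).eval x -
        n * (n + 2 * l) * (gegen l n).eval x := by
  rcases n with _ | n
  · simp [gegen]
  have hB : (1 - X ^ 2) * derivative (gegen l (n + 1)) =
      C ((n : ℝ) + 1) * (gegen l n - X * gegen l (n + 1)) :=
    Polynomial.funext fun y => by simpa using (gegen_derivative hl n y).2
  have hD := congrArg derivative hB
  simp only [derivative_mul, derivative_C, derivative_sub, derivative_X, derivative_one,
    derivative_X_pow, zero_mul, zero_add, one_mul] at hD
  have key : (1 - X ^ 2 : ℝ[X]) * ((1 - X ^ 2) * derivative (derivative (gegen l (n + 1)))) =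
      (1 - X ^ 2) * (C (2 * l + 1) * (X * derivative (gegen l (n + 1))) -
        C (((n : ℝ) + 1) * (n + 1 + 2 * l)) * gegen l (n + 1)) := by
    refine Polynomial.funext fun y => ?_
    have h1 := congrArg (eval y) hD
    obtain ⟨hA, hB⟩ := gegen_derivative hl n y
    simp only [eval_add, eval_mul, eval_sub, eval_C, eval_X, eval_one, eval_pow, eval_zero,
      Nat.cast_ofNat, pow_one, Nat.add_one_sub_one, map_ofNat, eval_ofNat] at h1 ⊢
    linear_combination (1 - y ^ 2) * h1 + (n + 1) * hA +
      (2 * y - (n + 1) * y - (2 * l + 1) * y) * hB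
  have hne : (1 - X ^ 2 : ℝ[X]) ≠ 0 := fun h => by
    simpa using congrArg (eval 0) h
  have h2 := congrArg (eval x) (mul_left_cancel₀ hne key)
  simp only [eval_mul, eval_sub, eval_C, eval_X, eval_one, eval_pow] at h2
  push_cast
  linear_combination h2

/-! ### Integration against powers of `1 - x²` -/

theorem continuous_one_sub_sq_rpow {e : ℝ} (he : 0 ≤ e) :
    Continuous fun x : ℝ => (1 - x ^ 2) ^ e :=
  Continuous.rpow_const (by fun_prop) fun _ => Or.inr he

/-- The integral over `[-1, 1]` of the derivative of `(1 - x²)^(e + 1) V` vanishes. -/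
theorem integral_weighted_derivative {E : Type*} [NormedAddCommGroup E] [NormedSpace ℝ E]
    [CompleteSpace E] {e : ℝ} (he : 0 ≤ e) {V V' : ℝ → E}
    (hV : ∀ x ∈ Set.Icc (-1 : ℝ) 1, HasDerivAt V (V' x) x)
    (hV' : ContinuousOn V' (Set.Icc (-1 : ℝ) 1)) :
    ∫ x in (-1 : ℝ)..1, ((1 - x ^ 2) ^ e : ℝ) •
      ((1 - x ^ 2) • V' x - (2 * (e + 1) * x) • V x) = 0 := by
  have hVc : ContinuousOn V (Set.Icc (-1 : ℝ) 1) := fun x hx =>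
    (hV x hx).continuousAt.continuousWithinAt
  have h := intervalIntegral.integral_eq_sub_of_hasDerivAt_of_le (a := (-1 : ℝ)) (b := 1)
    (f := fun x => ((1 - x ^ 2) ^ (e + 1) : ℝ) • V x)
    (f' := fun x => ((1 - x ^ 2) ^ e : ℝ) • ((1 - x ^ 2) • V' x - (2 * (e + 1) * x) • V x))
    (by norm_num)
    ((continuous_one_sub_sq_rpow (by positivity)).continuousOn.smul hVc) ?_ ?_
  · rw [h]
    have : e + 1 ≠ 0 := by positivity
    simp [Real.zero_rpow this]
  · intro x hx
    have hpos : 0 < 1 - x ^ 2 := by nlinarith [hx.1, hx.2]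
    have h1 : HasDerivAt (fun x : ℝ => 1 - x ^ 2) (-(2 * x)) x := by
      simpa using (hasDerivAt_pow 2 x).const_sub 1
    have h2 := (h1.rpow_const (p := e + 1) (Or.inl hpos.ne')).smul
      (hV x (Set.Ioo_subset_Icc_self hx))
    refine h2.congr_deriv ?_
    rw [add_sub_cancel_right, Real.rpow_add_one hpos.ne']
    module
  · refine ContinuousOn.intervalIntegrable ?_
    rw [Set.uIcc_of_le (by norm_num)]
    exact (continuous_one_sub_sq_rpow he).continuousOn.smul
      (((by fun_prop : Continuous fun x : ℝ => 1 - x ^ 2).continuousOn.smul hV').sub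
        ((by fun_prop : Continuous fun x : ℝ => 2 * (e + 1) * x).continuousOn.smul hVc))

/-- Self-adjointness of the Gegenbauer operator, tested against a polynomial `p`. -/
theorem integral_gegen_operator {l : ℝ} (hl : 1 / 2 ≤ l) (n : ℕ) (p : ℝ[X]) :
    ∫ x in (-1 : ℝ)..1, (1 - x ^ 2) ^ (l - 1 / 2) *
      ((n * (n + 2 * l) * p.eval x + (1 - x ^ 2) * (derivative (derivative p)).eval x -
        (2 * l + 1) * x * (derivative p).eval x) * (gegen l n).eval x) = 0 := by
  have h := integral_weighted_derivative (E := ℝ) (e := l - 1 / 2) (by linarith)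
    (V := fun x => (p * derivative (gegen l n) - derivative p * gegen l n).eval x)
    (V' := fun x => (derivative (p * derivative (gegen l n) - derivative p * gegen l n)).eval x)
    (fun x _ => Polynomial.hasDerivAt _ x) (Polynomial.continuous _).continuousOn
  rw [← neg_eq_zero, ← intervalIntegral.integral_neg, ← h]
  congr 1
  ext x
  have ho := gegen_ode (by linarith : 0 < l) n x
  simp only [smul_eq_mul, derivative_sub, derivative_mul, eval_sub, eval_add, eval_mul]
  linear_combination (-((1 - x ^ 2) ^ (l - 1 / 2) * p.eval x)) * ho

theorem gegen_orthogonal_X_pow {l : ℝ} (hl : 1 / 2 ≤ l) {n k : ℕ} (hk : k < n) :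
    ultraInner (l - 1 / 2) (X ^ k) (gegen l n) = 0 := by
  have hne : ∀ k : ℕ, k < n → (n : ℝ) * (n + 2 * l) - k * (k + 2 * l) ≠ 0 := by
    intro k hk
    have : (k : ℝ) < n := by exact_mod_cast hk
    have h0 : (0 : ℝ) ≤ k := k.cast_nonneg
    nlinarith
  induction k using Nat.twoStepInduction with
  | zero =>
    have h := integral_gegen_operator hl n 1
    refine (mul_eq_zero.1
      (?_ : ((n : ℝ) * (n + 2 * l) - (0 : ℕ) * ((0 : ℕ) + 2 * l)) * _ = 0)).resolve_left
      (hne 0 hk)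
    rw [← h, ultraInner, ← intervalIntegral.integral_const_mul]
    congr 1
    ext x
    simp
    ring
  | one =>
    have h := integral_gegen_operator hl n X
    refine (mul_eq_zero.1
      (?_ : ((n : ℝ) * (n + 2 * l) - (1 : ℕ) * ((1 : ℕ) + 2 * l)) * _ = 0)).resolve_left
      (hne 1 hk)
    rw [← h, ultraInner, ← intervalIntegral.integral_const_mul]
    congr 1
    ext x
    simp
    ring
  | more k h0 _ =>
    have h := integral_gegen_operator hl n (X ^ (k + 2))
    refine (mul_eq_zero.1
      (?_ : ((n : ℝ) * (n + 2 * l) - (k + 2 : ℕ) * ((k + 2 : ℕ) + 2 * l)) * _ = 0)).resolve_left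
      (hne _ hk)
    have h0' := h0 (by omega)
    have hβ : 0 ≤ l - 1 / 2 := by linarith
    have e1 : ((n : ℝ) * (n + 2 * l) - (k + 2 : ℕ) * ((k + 2 : ℕ) + 2 * l)) *
        ultraInner (l - 1 / 2) (X ^ (k + 2)) (gegen l n) -
        (-((k + 2) * (k + 1))) * ultraInner (l - 1 / 2) (X ^ k) (gegen l n) = 0 := by
      rw [← ultraInner_C_mul_left, ← ultraInner_C_mul_left, ← ultraInner_sub_left hβ, ← h,
        ultraInner]
      congr 1
      ext x
      simp only [derivative_X_pow, derivative_mul, eval_sub, eval_mul, eval_C,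
        eval_pow, eval_X, zero_mul, zero_add, Nat.add_one_sub_one, map_natCast,
        derivative_natCast, eval_natCast]
      push_cast
      ring
    rw [h0'] at e1
    linarith

theorem gegen_orthogonal {l : ℝ} (hl : 1 / 2 ≤ l) {n : ℕ} {r : ℝ[X]} (hr : r.degree < n) :
    ultraInner (l - 1 / 2) r (gegen l n) = 0 := by
  rcases eq_or_ne r 0 with rfl | h0
  · simp [ultraInner]
  have hd : r.natDegree < n := (natDegree_lt_iff_degree_lt h0).2 hr
  rw [r.as_sum_range_C_mul_X_pow' hd, ultraInner_sum_left (by linarith)]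
  refine Finset.sum_eq_zero fun k hk => ?_
  rw [ultraInner_C_mul_left, gegen_orthogonal_X_pow hl (Finset.mem_range.1 hk), mul_zero]

theorem jacobiP_eq_gegen {l : ℝ} (hl : 1 / 2 ≤ l) (n : ℕ) :
    jacobiP (l - 1 / 2) n = gegen l n := by
  have hβ : 0 ≤ l - 1 / 2 := by linarith
  obtain ⟨hm, hd⟩ := monicOrtho_degree (l - 1 / 2) n
  set c := (gegen l n).coeff n
  have hs : (gegen l n - C c * monicOrtho (l - 1 / 2) n).degree < n := by
    rw [degree_lt_iff_coeff_zero]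
    intro j hj
    rcases hj.eq_or_lt with rfl | hj
    · have := hm.coeff_natDegree
      rw [natDegree_eq_of_degree_eq_some hd] at this
      rw [coeff_sub, coeff_C_mul, this, mul_one, sub_self]
    · rw [coeff_sub, coeff_C_mul, coeff_eq_zero_of_natDegree_lt
        ((gegen_natDegree_le l n).trans_lt hj), coeff_eq_zero_of_degree_lt (n := j)
        (by rw [hd]; exact_mod_cast hj)]
      simp
  have h1 := gegen_orthogonal hl hs
  have h2 := monicOrtho_orthogonal_of_degree_lt hβ n _ hs
  have h3 : gegen l n - C c * monicOrtho (l - 1 / 2) n = 0 := by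
    by_contra hne
    have := ultraInner_self_pos hβ hne
    rw [ultraInner_sub_left hβ, ultraInner_C_mul_left, ultraInner_comm, h1,
      ultraInner_comm, h2] at this
    simp at this
  have h4 : gegen l n = C c * monicOrtho (l - 1 / 2) n := sub_eq_zero.1 h3
  have h5 := congrArg (eval 1) h4
  rw [gegen_eval_one (by linarith), eval_mul, eval_C] at h5
  rw [jacobiP, h4, ← eq_inv_of_mul_eq_one_left h5.symm]

/-! ### Power bounds for Pochhammer quotients -/

/-- A nonnegative sequence whose successive quotients are at most `1 + c / n + O(1 / n²)` is
`O(n ^ c)`. -/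
theorem exists_le_mul_rpow_of_ratio_le {u : ℕ → ℝ} (hu : ∀ n, 0 ≤ u n) {c C : ℝ} (hC : 0 ≤ C)
    (h : ∀ n : ℕ, u (n + 1) ≤ u n * (1 + c / (n + 1) + C / ((n : ℝ) + 1) ^ 2)) :
    ∃ K, 0 ≤ K ∧ ∀ n : ℕ, u n ≤ K * ((n : ℝ) + 1) ^ c := by
  have hs : Summable fun n : ℕ => 1 / ((n : ℝ) + 1) ^ 2 := by
    have := (summable_nat_add_iff 1).2 (Real.summable_one_div_nat_pow.2 one_lt_two)
    simpa using this
  set T := ∑' n : ℕ, 1 / ((n : ℝ) + 1) ^ 2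
  have hexp : ∀ n : ℕ, u n ≤ u 0 * Real.exp (c * (harmonic n : ℝ) +
      C * ∑ i ∈ Finset.range n, 1 / ((i : ℝ) + 1) ^ 2) := by
    intro n
    induction n with
    | zero => simp
    | succ n ih =>
      refine (h n).trans ?_
      calc u n * (1 + c / (n + 1) + C / ((n : ℝ) + 1) ^ 2)
          ≤ u n * Real.exp (c / (n + 1) + C / ((n : ℝ) + 1) ^ 2) :=
            mul_le_mul_of_nonneg_left (by
              linarith [Real.add_one_le_exp (c / ((n : ℝ) + 1) + C / ((n : ℝ) + 1) ^ 2)]) (hu n)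
        _ ≤ _ := mul_le_mul_of_nonneg_right ih (Real.exp_pos _).le
        _ = _ := by
          rw [mul_assoc, ← Real.exp_add, harmonic_succ, Finset.sum_range_succ]
          congr 2
          push_cast
          ring
  refine ⟨u 0 * Real.exp (|c| + C * T), mul_nonneg (hu 0) (Real.exp_pos _).le, fun n => ?_⟩
  refine (hexp n).trans ?_
  have hn : (0 : ℝ) < n + 1 := by positivity
  rw [Real.rpow_def_of_pos hn, mul_assoc, ← Real.exp_add]
  refine mul_le_mul_of_nonneg_left (Real.exp_le_exp.2 ?_) (hu 0)
  have h1 : C * ∑ i ∈ Finset.range n, 1 / ((i : ℝ) + 1) ^ 2 ≤ C * T :=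
    mul_le_mul_of_nonneg_left (hs.sum_le_tsum _ fun _ _ => by positivity) hC
  have h2 : Real.log (n + 1) ≤ (harmonic n : ℝ) := by exact_mod_cast log_add_one_le_harmonic n
  have h3 : (harmonic n : ℝ) ≤ 1 + Real.log (n + 1) := by
    refine (harmonic_le_one_add_log n).trans ?_
    rcases n.eq_zero_or_pos with rfl | h0
    · simp
    · have : (0 : ℝ) < n := by exact_mod_cast h0
      linarith [Real.log_le_log this (by linarith : (n : ℝ) ≤ n + 1)]
  have h4 : c * (harmonic n : ℝ) ≤ Real.log (n + 1) * c + |c| := by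
    rcases le_total 0 c with hc | hc
    · rw [abs_of_nonneg hc]; nlinarith
    · rw [abs_of_nonpos hc]; nlinarith
  linarith

/-- The quotient `(s)_n / n!` of the Pochhammer symbol by the factorial. -/
noncomputable def pochQuot (s : ℝ) : ℕ → ℝ
  | 0 => 1
  | n + 1 => pochQuot s n * ((s + n) / (n + 1))

theorem pochQuot_succ (s : ℝ) (n : ℕ) :
    pochQuot s (n + 1) = pochQuot s n * ((s + n) / (n + 1)) := rfl

theorem pochQuot_pos {s : ℝ} (hs : 0 < s) (n : ℕ) : 0 < pochQuot s n := by
  induction n with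
  | zero => simp [pochQuot]
  | succ n ih => rw [pochQuot]; positivity

theorem pochQuot_le {s : ℝ} (hs : 0 < s) :
    ∃ K, 0 ≤ K ∧ ∀ n : ℕ, pochQuot s n ≤ K * ((n : ℝ) + 1) ^ (s - 1) := by
  refine exists_le_mul_rpow_of_ratio_le (fun n => (pochQuot_pos hs n).le) le_rfl fun n => ?_
  rw [pochQuot]
  refine le_of_eq ?_
  field_simp
  ring

theorem inv_pochQuot_le {s : ℝ} (hs : 1 ≤ s) :
    ∃ K, 0 ≤ K ∧ ∀ n : ℕ, (pochQuot s n)⁻¹ ≤ K * ((n : ℝ) + 1) ^ (1 - s) := by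
  have hp := fun n => pochQuot_pos (by linarith : 0 < s) n
  refine exists_le_mul_rpow_of_ratio_le (C := (s - 1) ^ 2) (fun n => (inv_pos.2 (hp n)).le)
    (sq_nonneg _) fun n => ?_
  have hn : (0 : ℝ) ≤ n := n.cast_nonneg
  rw [pochQuot, mul_inv, inv_div]
  refine mul_le_mul_of_nonneg_left ?_ (inv_pos.2 (hp n)).le
  have : 1 + (1 - s) / ((n : ℝ) + 1) + (s - 1) ^ 2 / ((n : ℝ) + 1) ^ 2 - (n + 1) / (s + n) =
      (s - 1) ^ 3 / ((n + 1) ^ 2 * (s + n)) := by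
    field_simp
    ring
  have h3 : 0 ≤ (s - 1) ^ 3 / (((n : ℝ) + 1) ^ 2 * (s + n)) :=
    div_nonneg (pow_nonneg (by linarith) 3) (by positivity)
  linarith

theorem pochQuot_div_le {l : ℝ} (hl : 1 / 2 ≤ l) :
    ∃ K, 0 ≤ K ∧ ∀ n : ℕ, pochQuot (2 * l) n / pochQuot l n ≤ K * ((n : ℝ) + 1) ^ l := by
  have hp := fun n => pochQuot_pos (by linarith : 0 < l) n
  have hp2 := fun n => pochQuot_pos (by linarith : 0 < 2 * l) n
  refine exists_le_mul_rpow_of_ratio_le (C := 2 * l) (fun n => (div_pos (hp2 n) (hp n)).le)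
    (by linarith) fun n => ?_
  have hn : (0 : ℝ) ≤ n := n.cast_nonneg
  have hl0 : (0 : ℝ) < l := by linarith
  have e : pochQuot (2 * l) (n + 1) / pochQuot l (n + 1) =
      pochQuot (2 * l) n / pochQuot l n * ((2 * l + n) / (l + n)) := by
    have := (hp n).ne'
    rw [pochQuot, pochQuot]
    field_simp
  rw [e]
  refine mul_le_mul_of_nonneg_left ?_ (div_pos (hp2 n) (hp n)).le
  have : 1 + l / ((n : ℝ) + 1) + 2 * l / ((n : ℝ) + 1) ^ 2 - (2 * l + n) / (l + n) =
      l * ((l - 1) * (n + 1) + 2 * (l + n)) / ((n + 1) ^ 2 * (l + n)) := by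
    field_simp
    ring
  have h3 : 0 ≤ l * ((l - 1) * (n + 1) + 2 * (l + n)) / (((n : ℝ) + 1) ^ 2 * (l + n)) := by
    refine div_nonneg (mul_nonneg hl0.le ?_) (by positivity)
    nlinarith
  linarith

/-! ### Linearization of products -/

/-- Dougall's linearization coefficient for the normalized Gegenbauer polynomials: the coefficient
of `R_{A + B}` in the product `R_{A + J} R_{B + J}`. -/
noncomputable def dougall (l : ℝ) (A B J : ℕ) : ℝ :=
  (A + B + l) / (A + B + J + l) * (pochQuot l A * pochQuot l B * pochQuot l J) *
    (pochQuot (2 * l) (A + B + J) / pochQuot l (A + B + J)) *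
    ((pochQuot (2 * l) (A + J))⁻¹ * (pochQuot (2 * l) (B + J))⁻¹)

theorem dougall_nonneg {l : ℝ} (hl : 0 < l) (A B J : ℕ) : 0 ≤ dougall l A B J := by
  have h := fun n => pochQuot_pos hl n
  have h2 := fun n => pochQuot_pos (by linarith : 0 < 2 * l) n
  have := h A; have := h B; have := h J; have := h (A + B + J); have := h2 (A + B + J)
  have := h2 (A + J); have := h2 (B + J)
  unfold dougall
  positivity

theorem dougall_zero {l : ℝ} (hl : 0 < l) (n : ℕ) : dougall l 0 n 0 = 1 := by
  have h1 := (pochQuot_pos hl n).ne'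
  have h2 := (pochQuot_pos (by linarith : 0 < 2 * l) n).ne'
  have : (n : ℝ) + l ≠ 0 := by positivity
  simp only [dougall, pochQuot, zero_add, add_zero, Nat.cast_zero]
  generalize pochQuot (2 * l) n = y at *
  field_simp

theorem dougall_succ_left {l : ℝ} (hl : 0 < l) (A B : ℕ) :
    (A + 2 * l) * dougall l (A + 1) B 0 =
      (A + l) * dougall l A B 0 * ((A + B + 2 * l) / (A + B + l)) := by
  have h1 := (pochQuot_pos hl A).ne'
  have h2 := (pochQuot_pos hl B).ne'
  have h3 := (pochQuot_pos hl (A + B)).ne'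
  have h4 := (pochQuot_pos (by linarith : 0 < 2 * l) A).ne'
  have h5 := (pochQuot_pos (by linarith : 0 < 2 * l) B).ne'
  simp only [dougall, add_zero, Nat.cast_zero, show A + 1 + B = A + B + 1 by ring, pochQuot]
  generalize pochQuot (2 * l) A = y at *
  generalize pochQuot (2 * l) B = z at *
  generalize pochQuot (2 * l) (A + B) = w at *
  push_cast
  field_simp
  ring

theorem dougall_zero_left {l : ℝ} (hl : 0 < l) (B J : ℕ) :
    (J + 2 * l) * dougall l 0 B (J + 1) =
      (J + l) * dougall l 0 (B + 1) J * ((B + 1) / (B + 1 + l)) := by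
  have h1 := (pochQuot_pos hl J).ne'
  have h2 := (pochQuot_pos hl B).ne'
  have h3 := (pochQuot_pos hl (B + J + 1)).ne'
  have h4 := (pochQuot_pos (by linarith : 0 < 2 * l) J).ne'
  have h5 := (pochQuot_pos (by linarith : 0 < 2 * l) (B + J + 1)).ne'
  simp only [dougall, zero_add, Nat.cast_zero, show B + 1 + J = B + J + 1 by ring,
    show B + (J + 1) = B + J + 1 by ring, pochQuot_succ l J, pochQuot_succ l B,
    pochQuot_succ (2 * l) J]
  generalize pochQuot (2 * l) J = y at *
  generalize pochQuot (2 * l) (B + J + 1) = z at *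
  generalize pochQuot l (B + J + 1) = w at *
  push_cast
  field_simp
  ring

theorem dougall_rec {l : ℝ} (hl : 0 < l) (A B J : ℕ) :
    (A + J + 1 + 2 * l) * dougall l (A + 1) B (J + 1) =
      (A + J + 1 + l) * dougall l A B (J + 1) * ((A + B + 2 * l) / (A + B + l)) +
      (A + J + 1 + l) * dougall l (A + 1) (B + 1) J * ((A + B + 2) / (A + B + 2 + l)) -
      (A + J + 1) * dougall l A (B + 1) J := by
  have h1 := (pochQuot_pos hl A).ne'
  have h2 := (pochQuot_pos hl J).ne'
  have h3 := (pochQuot_pos hl B).ne'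
  have h4 := (pochQuot_pos hl (A + B + J + 1)).ne'
  have h5 := (pochQuot_pos (by linarith : 0 < 2 * l) (A + J)).ne'
  have h6 := (pochQuot_pos (by linarith : 0 < 2 * l) (B + J + 1)).ne'
  simp only [dougall, show A + 1 + B + (J + 1) = A + B + J + 1 + 1 by ring,
    show A + 1 + (J + 1) = A + J + 1 + 1 by ring, show B + (J + 1) = B + J + 1 by ring,
    show A + B + (J + 1) = A + B + J + 1 by ring, show A + (J + 1) = A + J + 1 by ring,
    show A + 1 + (B + 1) + J = A + B + J + 1 + 1 by ring, show A + 1 + J = A + J + 1 by ring,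
    show B + 1 + J = B + J + 1 by ring, show A + (B + 1) + J = A + B + J + 1 by ring]
  rw [pochQuot_succ l A, pochQuot_succ l B, pochQuot_succ l J, pochQuot_succ l (A + B + J + 1),
    pochQuot_succ (2 * l) (A + B + J + 1), pochQuot_succ (2 * l) (A + J + 1),
    pochQuot_succ (2 * l) (A + J)]
  generalize pochQuot (2 * l) (A + J) = y at *
  generalize pochQuot (2 * l) (A + B + J + 1) = v at *
  generalize pochQuot (2 * l) (B + J + 1) = z at *
  generalize pochQuot l (A + B + J + 1) = w at *
  generalize pochQuot l A = a at *
  generalize pochQuot l B = b at *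
  generalize pochQuot l J = c at *
  push_cast
  have hA : (0 : ℝ) ≤ A := A.cast_nonneg
  have hB : (0 : ℝ) ≤ B := B.cast_nonneg
  have hJ : (0 : ℝ) ≤ J := J.cast_nonneg
  generalize (A : ℝ) = A at *
  generalize (B : ℝ) = B at *
  generalize (J : ℝ) = J at *
  have key : (A + 1 + B + l) * (l + A) * (l + J) * (2 * l + (A + B + J + 1)) * (A + J + 2) /
        ((A + B + J + 2 + l) * (A + 1) * (J + 1) * (l + (A + B + J + 1)) * (2 * l + (A + J))) =
      (A + J + 1 + l) * (l + J) * (A + B + 2 * l) /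
        ((A + B + J + 1 + l) * (J + 1) * (2 * l + (A + J))) +
      (A + J + 1 + l) * (l + A) * (l + B) * (2 * l + (A + B + J + 1)) * (A + B + 2) /
        ((A + B + J + 2 + l) * (A + 1) * (B + 1) * (l + (A + B + J + 1)) * (2 * l + (A + J))) -
      (A + B + 1 + l) * (l + B) / ((A + B + J + 1 + l) * (B + 1)) := by
    field_simp
    ring
  -- All four terms are a rational function of `A`, `B`, `J`, `l` times `a b c v / (w y z)`.
  have h := congrArg (fun t => (A + J + 1) * t * (a * b * c * v / (w * y * z))) key
  refine Eq.trans ?_ (h.trans ?_)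
  · clear key h
    field_simp
    ring
  · clear key h
    rw [mul_sub, mul_add, sub_mul, add_mul]
    congr 1
    · congr 1
      · field_simp
        ring
      · field_simp
        ring
    · field_simp
      ring

theorem gegen_X_mul {l : ℝ} (hl : 0 < l) (n : ℕ) (x : ℝ) :
    2 * (n + l) * (x * (gegen l n).eval x) =
      (n + 2 * l) * (gegen l (n + 1)).eval x + n * (gegen l (n - 1)).eval x := by
  rcases n with _ | n
  · simp [gegen]
  · have := gegen_eval_rec hl n x
    push_cast
    linear_combination -this

/-- The linearization coefficient of `R_{m + n - 2j}` in `R_m R_n` for `m ≤ n`, extended by zero to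
`j > m`. The truncated differences are genuine for `j ≤ m ≤ n`. -/
noncomputable def linCoeff (l : ℝ) (m n j : ℕ) : ℝ :=
  if j ≤ m then dougall l (m - j) (n - j) j else 0

theorem linCoeff_nonneg {l : ℝ} (hl : 0 < l) (m n j : ℕ) : 0 ≤ linCoeff l m n j := by
  unfold linCoeff
  split_ifs
  exacts [dougall_nonneg hl _ _ _, le_rfl]

theorem linCoeff_eq_zero {l : ℝ} {m n j : ℕ} (h : m < j) : linCoeff l m n j = 0 :=
  if_neg (by omega)

theorem linCoeff_succ_zero {l : ℝ} (hl : 0 < l) (m n : ℕ) :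
    (m + 2 * l) * linCoeff l (m + 1) n 0 =
      (m + l) * linCoeff l m n 0 * ((m + n + 2 * l) / (m + n + l)) := by
  simpa [linCoeff] using dougall_succ_left hl m n

/-- The recurrence for the linearization coefficients that matches the three-term recurrence of the
`R_m`. Besides the generic case it covers the last coefficient `j = m`. -/
theorem linCoeff_succ_succ {l : ℝ} (hl : 0 < l) {m n j : ℕ} (hmn : m < n) (hj : j ≤ m) :
    (m + 2 * l) * linCoeff l (m + 1) n (j + 1) =
      (m + l) * linCoeff l m n (j + 1) *
        (((m + n - 2 * (j + 1 : ℕ) : ℕ) + 2 * l) / ((m + n - 2 * (j + 1) : ℕ) + l)) +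
      (m + l) * linCoeff l m n j * ((m + n - 2 * j : ℕ) / ((m + n - 2 * j : ℕ) + l)) -
      m * linCoeff l (m - 1) n j := by
  obtain ⟨B, rfl⟩ : ∃ B, n = B + (j + 1) := ⟨n - (j + 1), by omega⟩
  rcases hj.eq_or_lt with rfl | hj
  · have h := dougall_zero_left hl B j
    have h0 : (j : ℝ) * linCoeff l (j - 1) (B + (j + 1)) j = 0 := by
      rcases j with _ | j
      · simp
      · rw [linCoeff_eq_zero (by omega), mul_zero]
    rw [h0, linCoeff_eq_zero (m := j) (j := j + 1) (by omega), linCoeff, linCoeff, if_pos le_rfl,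
      if_pos le_rfl, Nat.sub_self, Nat.sub_self, show B + (j + 1) - (j + 1) = B by omega,
      show B + (j + 1) - j = B + 1 by omega, show j + (B + (j + 1)) - 2 * j = B + 1 by omega, h]
    push_cast
    ring
  · obtain ⟨A, rfl⟩ : ∃ A, m = A + (j + 1) := ⟨m - (j + 1), by omega⟩
    have h := dougall_rec hl A B j
    rw [linCoeff, linCoeff, linCoeff, linCoeff, if_pos (by omega), if_pos (by omega),
      if_pos (by omega), if_pos (by omega), show A + (j + 1) + 1 - (j + 1) = A + 1 by omega,
      show A + (j + 1) - (j + 1) = A by omega, show A + (j + 1) - j = A + 1 by omega,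
      show A + (j + 1) - 1 - j = A by omega, show B + (j + 1) - (j + 1) = B by omega,
      show B + (j + 1) - j = B + 1 by omega,
      show A + (j + 1) + (B + (j + 1)) - 2 * (j + 1) = A + B by omega,
      show A + (j + 1) + (B + (j + 1)) - 2 * j = A + B + 2 by omega]
    push_cast
    simp only [← add_assoc]
    linear_combination h

/-- **Dougall's linearization formula** for normalized Gegenbauer polynomials. -/
theorem gegen_mul_gegen {l : ℝ} (hl : 0 < l) (n : ℕ) (x : ℝ) :
    ∀ m ≤ n, (gegen l m).eval x * (gegen l n).eval x =
      ∑ j ∈ Finset.range (m + 1), linCoeff l m n j * (gegen l (m + n - 2 * j)).eval x := by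
  intro m
  induction m using Nat.strong_induction_on with
  | _ m ih =>
  intro hmn
  rcases m with _ | m
  · simp [linCoeff, gegen, dougall_zero hl]
  have h1 := ih m (by omega) (by omega)
  set Q : ℕ → ℝ := fun j => (gegen l (m + 1 + n - 2 * j)).eval x with hQ
  -- the product `R_{m-1} R_n`, whose coefficient `m` makes it vanish for `m = 0`
  have h0 : m * ((gegen l (m - 1)).eval x * (gegen l n).eval x) =
      ∑ j ∈ Finset.range (m + 1), m * linCoeff l (m - 1) n j * Q (j + 1) := by
    rcases m with _ | m
    · simp
    · rw [Nat.add_sub_cancel, ih m (by omega) (by omega), Finset.sum_range_succ _ (m + 1),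
        linCoeff_eq_zero (by omega : m < m + 1), mul_zero, zero_mul, add_zero, Finset.mul_sum]
      refine Finset.sum_congr rfl fun j _ => ?_
      rw [hQ, mul_assoc]
      beta_reduce
      rw [show m + 1 + 1 + n - 2 * (j + 1) = m + n - 2 * j by omega]
  set U : ℕ → ℝ := fun j => (m + l) * linCoeff l m n j *
    (((m + n - 2 * j : ℕ) + 2 * l) / ((m + n - 2 * j : ℕ) + l)) with hU
  set V : ℕ → ℝ := fun j => (m + l) * linCoeff l m n j *
    ((m + n - 2 * j : ℕ) / ((m + n - 2 * j : ℕ) + l)) with hV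
  have h2 : 2 * (m + l) * (x * ((gegen l m).eval x * (gegen l n).eval x)) =
      ∑ j ∈ Finset.range (m + 1), (U j * Q j + V j * Q (j + 1)) := by
    rw [h1, Finset.mul_sum, Finset.mul_sum]
    refine Finset.sum_congr rfl fun j hj => ?_
    have hj := Finset.mem_range.1 hj
    have hx := gegen_X_mul hl (m + n - 2 * j) x
    rw [show m + n - 2 * j + 1 = m + 1 + n - 2 * j by omega,
      show m + n - 2 * j - 1 = m + 1 + n - 2 * (j + 1) by omega] at hx
    have hk : ((m + n - 2 * j : ℕ) : ℝ) + l ≠ 0 := by positivity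
    simp only [hU, hV, hQ]
    field_simp
    linear_combination linCoeff l m n j * hx
  have h3 : ∑ j ∈ Finset.range (m + 1), U j * Q j =
      ∑ j ∈ Finset.range (m + 1), U (j + 1) * Q (j + 1) + U 0 * Q 0 := by
    rw [← Finset.sum_range_succ' (fun j => U j * Q j), Finset.sum_range_succ _ (m + 1)]
    simp [hU, linCoeff_eq_zero]
  have hm : (m : ℝ) + 2 * l ≠ 0 := by positivity
  have hx := gegen_X_mul hl m x
  refine mul_left_cancel₀ hm ?_
  rw [Finset.sum_range_succ', mul_add, Finset.mul_sum, ← mul_assoc _ (linCoeff _ _ _ 0),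
    linCoeff_succ_zero hl]
  have h4 : ∀ j ∈ Finset.range (m + 1), ((m : ℝ) + 2 * l) * (linCoeff l (m + 1) n (j + 1) *
      (gegen l (m + 1 + n - 2 * (j + 1))).eval x) =
      U (j + 1) * Q (j + 1) + V j * Q (j + 1) - m * linCoeff l (m - 1) n j * Q (j + 1) := by
    intro j hj
    rw [← mul_assoc, linCoeff_succ_succ hl (by omega) (by have := Finset.mem_range.1 hj; omega)]
    simp only [hU, hV, hQ]
    ring
  rw [Finset.sum_congr rfl h4, Finset.sum_sub_distrib, Finset.sum_add_distrib, ← h0]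
  rw [Finset.sum_add_distrib, h3] at h2
  have h5 : (m + l) * linCoeff l m n 0 * ((m + n + 2 * l) / (m + n + l)) *
      (gegen l (m + 1 + n - 2 * 0)).eval x = U 0 * Q 0 := by
    simp [hU, hQ]
  rw [h5]
  linear_combination h2 - (gegen l n).eval x * hx

theorem sum_linCoeff {l : ℝ} (hl : 0 < l) {m n : ℕ} (hmn : m ≤ n) :
    ∑ j ∈ Finset.range (m + 1), linCoeff l m n j = 1 := by
  simpa [gegen_eval_one hl] using (gegen_mul_gegen hl n 1 m hmn).symm

/-- By linearization, `R_n²` has the same mean as a convex combination of `R_0, R_2, …`. -/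
theorem ultraInner_gegen_self_le {l : ℝ} (hl : 1 / 2 ≤ l) (n : ℕ) :
    ultraInner (l - 1 / 2) (gegen l n) (gegen l n) ≤ ultraInner (l - 1 / 2) 1 1 := by
  have hβ : 0 ≤ l - 1 / 2 := by linarith
  have hl0 : 0 < l := by linarith
  have e : ultraInner (l - 1 / 2) (gegen l n) (gegen l n) =
      ultraInner (l - 1 / 2)
        (∑ j ∈ Finset.range (n + 1), C (linCoeff l n n j) * gegen l (n + n - 2 * j)) 1 := by
    unfold ultraInner
    congr 1
    ext x
    rw [gegen_mul_gegen hl0 n x n le_rfl]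
    simp [eval_finsetSum]
  have h1 : 0 ≤ ultraInner (l - 1 / 2) 1 1 := (ultraInner_self_pos hβ one_ne_zero).le
  rw [e, ultraInner_sum_left hβ]
  calc _ ≤ ∑ j ∈ Finset.range (n + 1), linCoeff l n n j * ultraInner (l - 1 / 2) 1 1 := by
        refine Finset.sum_le_sum fun j _ => ?_
        rw [ultraInner_C_mul_left]
        refine mul_le_mul_of_nonneg_left ?_ (linCoeff_nonneg hl0 _ _ _)
        rcases (n + n - 2 * j).eq_zero_or_pos with h | h
        · rw [h, gegen]
        · rw [ultraInner_comm, gegen_orthogonal hl]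
          · exact h1
          · rw [degree_one]
            exact_mod_cast h
    _ = _ := by rw [← Finset.sum_mul, sum_linCoeff hl0 le_rfl, one_mul]

/-! ### Moments against Gegenbauer polynomials -/

/-- The weighted moment `∫_{-1}^1 (1 - x²)^e q(x) p(x) dx` of a function `q` against a real
polynomial `p`. -/
noncomputable def ultraMoment (e : ℝ) (q : ℂ → ℂ) (p : ℝ[X]) : ℂ :=
  ∫ x in (-1 : ℝ)..1, ((1 - x ^ 2) ^ e : ℝ) • (q x * ((p.eval x : ℝ) : ℂ))

theorem ultraMoment_intervalIntegrable {e : ℝ} (he : 0 ≤ e) {q : ℂ → ℂ}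
    (hq : ContinuousOn (fun x : ℝ => q x) (Set.Icc (-1) 1)) (p : ℝ[X]) :
    IntervalIntegrable (fun x : ℝ => ((1 - x ^ 2) ^ e : ℝ) • (q x * ((p.eval x : ℝ) : ℂ)))
      volume (-1) 1 := by
  refine ContinuousOn.intervalIntegrable ?_
  rw [Set.uIcc_of_le (by norm_num)]
  exact (continuous_one_sub_sq_rpow he).continuousOn.smul
    (hq.mul (Complex.continuous_ofReal.comp p.continuous).continuousOn)

theorem ultraMoment_congr {e : ℝ} {q q' : ℂ → ℂ} {p p' : ℝ[X]}
    (h : ∀ x ∈ Set.Icc (-1 : ℝ) 1, q x * ((p.eval x : ℝ) : ℂ) = q' x * ((p'.eval x : ℝ) : ℂ)) :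
    ultraMoment e q p = ultraMoment e q' p' := by
  refine intervalIntegral.integral_congr fun x hx => ?_
  rw [Set.uIcc_of_le (by norm_num)] at hx
  simp only [h x hx]

theorem ultraMoment_add {e : ℝ} (he : 0 ≤ e) {q r : ℂ → ℂ}
    (hq : ContinuousOn (fun x : ℝ => q x) (Set.Icc (-1) 1))
    (hr : ContinuousOn (fun x : ℝ => r x) (Set.Icc (-1) 1)) (p : ℝ[X]) :
    ultraMoment e (fun z => q z + r z) p = ultraMoment e q p + ultraMoment e r p := by
  unfold ultraMoment
  rw [← intervalIntegral.integral_add (ultraMoment_intervalIntegrable he hq p)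
    (ultraMoment_intervalIntegrable he hr p)]
  congr 1
  ext x
  rw [add_mul, smul_add]

theorem ultraMoment_const_mul (e : ℝ) (c : ℂ) (q : ℂ → ℂ) (p : ℝ[X]) :
    ultraMoment e (fun z => c * q z) p = c * ultraMoment e q p := by
  unfold ultraMoment
  rw [← intervalIntegral.integral_const_mul]
  congr 1
  ext x
  rw [mul_assoc, mul_smul_comm]

theorem ultraMoment_sum {e : ℝ} (he : 0 ≤ e) {q : ℂ → ℂ}
    (hq : ContinuousOn (fun x : ℝ => q x) (Set.Icc (-1) 1)) {ι : Type*} (s : Finset ι)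
    (c : ι → ℝ) (p : ι → ℝ[X]) :
    ultraMoment e q (∑ i ∈ s, C (c i) * p i) = ∑ i ∈ s, (c i : ℂ) * ultraMoment e q (p i) := by
  unfold ultraMoment
  simp only [← intervalIntegral.integral_const_mul]
  rw [← intervalIntegral.integral_finsetSum
    fun i _ => (ultraMoment_intervalIntegrable he hq (p i)).const_mul _]
  congr 1
  ext x
  simp only [eval_finsetSum, eval_mul, eval_C, Complex.ofReal_sum, Complex.ofReal_mul,
    Finset.mul_sum, Finset.smul_sum]
  refine Finset.sum_congr rfl fun i _ => ?_
  rw [mul_left_comm, mul_smul_comm]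

/-- Moments against the `R_n` are bounded, by the uniform bound for `∫ (1 - x²)^(l - 1/2) R_n²`. -/
theorem norm_ultraMoment_gegen_le {l e : ℝ} (hl : 1 / 2 ≤ l) (he : l - 1 / 2 ≤ e) {q : ℂ → ℂ}
    (hq : ContinuousOn (fun x : ℝ => q x) (Set.Icc (-1) 1)) :
    ∃ K, 0 ≤ K ∧ ∀ n, ‖ultraMoment e q (gegen l n)‖ ≤ K := by
  obtain ⟨M, hM⟩ := isCompact_Icc.exists_bound_of_continuousOn hq
  have hM0 : 0 ≤ M := (norm_nonneg _).trans (hM 0 (by norm_num))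
  have hβ : 0 ≤ l - 1 / 2 := by linarith
  have h1 : 0 ≤ ultraInner (l - 1 / 2) 1 1 := (ultraInner_self_pos hβ one_ne_zero).le
  refine ⟨M * (ultraInner (l - 1 / 2) 1 1 + ultraInner (l - 1 / 2) 1 1), by positivity,
    fun n => ?_⟩
  have hi := fun p : ℝ[X] => (ultraInner_continuous hβ p p).intervalIntegrable (μ := volume) (-1) 1
  calc ‖ultraMoment e q (gegen l n)‖
      ≤ ∫ x in (-1 : ℝ)..1, M * ((1 - x ^ 2) ^ (l - 1 / 2) * (eval x 1 * eval x 1) +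
          (1 - x ^ 2) ^ (l - 1 / 2) * ((gegen l n).eval x * (gegen l n).eval x)) := by
        refine intervalIntegral.norm_integral_le_of_norm_le (by norm_num) ?_
          (((hi 1).add (hi _)).const_mul M)
        refine Filter.Eventually.of_forall fun x hx => ?_
        have hx' : x ∈ Set.Icc (-1 : ℝ) 1 := Set.Ioc_subset_Icc_self hx
        have h0 : 0 ≤ 1 - x ^ 2 := by nlinarith [hx'.1, hx'.2]
        have hw : (1 - x ^ 2) ^ e ≤ (1 - x ^ 2) ^ (l - 1 / 2) := by
          rcases h0.eq_or_lt with h | h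
          · rw [← h]
            rcases hβ.eq_or_lt with h' | h'
            · rw [← h', Real.rpow_zero]
              exact Real.zero_rpow_le_one e
            · rw [Real.zero_rpow h'.ne', Real.zero_rpow (h'.trans_le he).ne']
          · exact Real.rpow_le_rpow_of_exponent_ge h (by nlinarith) he
        rw [norm_smul, norm_mul, Complex.norm_real, Real.norm_eq_abs, Real.norm_eq_abs,
          abs_of_nonneg (Real.rpow_nonneg h0 _)]
        have hw0 : 0 ≤ (1 - x ^ 2) ^ e := Real.rpow_nonneg h0 _
        have hP : |(gegen l n).eval x| ≤ 1 + (gegen l n).eval x * (gegen l n).eval x := by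
          nlinarith [sq_nonneg (|(gegen l n).eval x| - 1), sq_abs ((gegen l n).eval x),
            abs_nonneg ((gegen l n).eval x)]
        calc (1 - x ^ 2) ^ e * (‖q x‖ * |(gegen l n).eval x|)
            ≤ (1 - x ^ 2) ^ (l - 1 / 2) *
              (M * (1 + (gegen l n).eval x * (gegen l n).eval x)) := by
              gcongr
              exact hM x hx'
          _ = _ := by rw [eval_one]; ring
    _ = M * (ultraInner (l - 1 / 2) 1 1 +
          ultraInner (l - 1 / 2) (gegen l n) (gegen l n)) := by
        rw [intervalIntegral.integral_const_mul, intervalIntegral.integral_add (hi 1) (hi _)]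
        rfl
    _ ≤ _ := by
        gcongr
        exact ultraInner_gegen_self_le hl n

/-- The function `F` with `L ((1 - x²)^t r) = (1 - x²)^(t - 1) F`, where `L` is the differential
operator `-(1 - x²)^(1/2 - l) d/dx (1 - x²)^(l + 1/2) d/dx` with `L R_n = n (n + 2l) R_n`. -/
noncomputable def gegenLift (l t : ℝ) (r : ℂ → ℂ) (z : ℂ) : ℂ :=
  -((1 - z ^ 2) ^ 2 * deriv (deriv r) z - (2 * l + 4 * t + 1) * z * (1 - z ^ 2) * deriv r z -
    2 * t * (1 - z ^ 2) * r z + 4 * t * (l - 1 / 2 + t) * z ^ 2 * r z)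

section Analytic

variable {U : Set ℂ}

theorem continuousOn_segment (hseg : ∀ x ∈ Set.Icc (-1 : ℝ) 1, (x : ℂ) ∈ U) {r : ℂ → ℂ}
    (hr : DifferentiableOn ℂ r U) : ContinuousOn (fun x : ℝ => r x) (Set.Icc (-1) 1) :=
  hr.continuousOn.comp Complex.continuous_ofReal.continuousOn hseg

theorem differentiableOn_gegenLift (hU : IsOpen U) (l t : ℝ) {r : ℂ → ℂ}
    (hr : DifferentiableOn ℂ r U) : DifferentiableOn ℂ (gegenLift l t r) U := by
  have h1 := hr.deriv hU
  have h2 := h1.deriv hU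
  unfold gegenLift
  fun_prop

theorem ultraMoment_gegenLift (hU : IsOpen U) (hseg : ∀ x ∈ Set.Icc (-1 : ℝ) 1, (x : ℂ) ∈ U)
    {l t e : ℝ} (hl : 0 < l) (he : 0 ≤ e) (het : e = l + t - 3 / 2) {r : ℂ → ℂ}
    (hr : DifferentiableOn ℂ r U) (n : ℕ) :
    (n * (n + 2 * l) : ℂ) * ultraMoment (e + 1) r (gegen l n) =
      ultraMoment e (gegenLift l t r) (gegen l n) := by
  have hr1 := hr.deriv hU
  have hr2 := hr1.deriv hU
  have c0 := continuousOn_segment hseg hr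
  have c1 := continuousOn_segment hseg hr1
  have c2 := continuousOn_segment hseg hr2
  have hd : ∀ {f : ℂ → ℂ}, DifferentiableOn ℂ f U → ∀ x ∈ Set.Icc (-1 : ℝ) 1,
      HasDerivAt (fun y : ℝ => f y) (deriv f x) x := fun hf x hx =>
    ((hf.differentiableAt (hU.mem_nhds (hseg x hx))).hasDerivAt).comp_ofReal
  have hp : ∀ (p : ℝ[X]) (x : ℝ), HasDerivAt (fun y : ℝ => ((p.eval y : ℝ) : ℂ))
      (((derivative p).eval x : ℝ) : ℂ) x := fun p x => (p.hasDerivAt x).ofReal_comp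
  have hpc : ∀ p : ℝ[X], Continuous fun y : ℝ => ((p.eval y : ℝ) : ℂ) := fun p =>
    Complex.continuous_ofReal.comp p.continuous
  set P := gegen l n with hP
  -- the bracket `(1 - x²) (F P' - F' P) / (1 - x²)^(t - 1)` for `F = (1 - x²)^t r`
  have h := integral_weighted_derivative (E := ℂ) he
    (V := fun x : ℝ => (1 - (x : ℂ) ^ 2) * r x * (((derivative P).eval x : ℝ) : ℂ) -
      ((1 - (x : ℂ) ^ 2) * deriv r x - 2 * t * x * r x) * ((P.eval x : ℝ) : ℂ))
    (V' := fun x : ℝ =>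
      ((-(2 * (x : ℂ)) * r x + (1 - (x : ℂ) ^ 2) * deriv r x) *
          (((derivative P).eval x : ℝ) : ℂ) +
        (1 - (x : ℂ) ^ 2) * r x * (((derivative (derivative P)).eval x : ℝ) : ℂ)) -
      ((-(2 * (x : ℂ)) * deriv r x + (1 - (x : ℂ) ^ 2) * deriv (deriv r) x -
          (2 * t * r x + 2 * t * x * deriv r x)) * ((P.eval x : ℝ) : ℂ) +
        ((1 - (x : ℂ) ^ 2) * deriv r x - 2 * t * x * r x) *
          (((derivative P).eval x : ℝ) : ℂ)))
    (fun x hx => by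
      have hx1 : HasDerivAt (fun y : ℝ => (y : ℂ)) 1 x := (hasDerivAt_id x).ofReal_comp
      have hx2 : HasDerivAt (fun y : ℝ => 1 - (y : ℂ) ^ 2) (-(2 * (x : ℂ))) x := by
        simpa using (hx1.pow 2).const_sub 1
      have hx3 : HasDerivAt (fun y : ℝ => 2 * (t : ℂ) * y) (2 * (t : ℂ)) x := by
        simpa using hx1.const_mul (2 * (t : ℂ))
      exact ((hx2.mul (hd hr x hx)).mul (hp _ x)).sub
        (((hx2.mul (hd hr1 x hx)).sub (hx3.mul (hd hr x hx))).mul (hp _ x)))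
    (by
      have hxc : Continuous fun y : ℝ => (y : ℂ) := Complex.continuous_ofReal
      have d0 := (hpc P).continuousOn (s := Set.Icc (-1) 1)
      have d1 := (hpc (derivative P)).continuousOn (s := Set.Icc (-1) 1)
      have d2 := (hpc (derivative (derivative P))).continuousOn (s := Set.Icc (-1) 1)
      have k1 := (continuous_const.sub (hxc.pow 2) :
        Continuous fun y : ℝ => 1 - (y : ℂ) ^ 2).continuousOn (s := Set.Icc (-1) 1)
      have k2 := ((continuous_const.mul hxc).neg :
        Continuous fun y : ℝ => -(2 * (y : ℂ))).continuousOn (s := Set.Icc (-1) 1)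
      have k3 := (continuous_const.mul hxc :
        Continuous fun y : ℝ => 2 * (t : ℂ) * y).continuousOn (s := Set.Icc (-1) 1)
      exact ((((k2.mul c0).add (k1.mul c1)).mul d1).add ((k1.mul c0).mul d2)).sub
        (((((k2.mul c1).add (k1.mul c2)).sub ((continuousOn_const.mul c0).add (k3.mul c1))).mul
          d0).add (((k1.mul c1).sub (k3.mul c0)).mul d1)))
  rw [ultraMoment, ultraMoment, ← intervalIntegral.integral_const_mul, ← sub_eq_zero,
    ← intervalIntegral.integral_sub, ← neg_eq_zero, ← intervalIntegral.integral_neg, ← h]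
  · refine intervalIntegral.integral_congr fun x hx => ?_
    rw [Set.uIcc_of_le (by norm_num)] at hx
    have h0 : 0 ≤ 1 - x ^ 2 := by nlinarith [hx.1, hx.2]
    have ho : (1 - (x : ℂ) ^ 2) * (((derivative (derivative P)).eval x : ℝ) : ℂ) =
        (2 * l + 1) * x * (((derivative P).eval x : ℝ) : ℂ) -
          n * (n + 2 * l) * ((P.eval x : ℝ) : ℂ) := by
      exact_mod_cast congrArg (fun y : ℝ => (y : ℂ)) (gegen_ode hl n x)
    have hpow : (1 - x ^ 2) ^ (e + 1) = (1 - x ^ 2) ^ e * (1 - x ^ 2) := by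
      rw [Real.rpow_add_of_nonneg h0 he zero_le_one, Real.rpow_one]
    simp only [hpow, gegenLift, Complex.real_smul]
    have hec : (e : ℂ) = l + t - 3 / 2 := by rw [het]; push_cast; ring
    push_cast
    rw [hec]
    linear_combination (-((1 - x ^ 2) ^ e : ℝ) * (1 - (x : ℂ) ^ 2) * r x) * ho
  · exact (ultraMoment_intervalIntegrable (by positivity) c0 P).const_mul _
  · exact ultraMoment_intervalIntegrable he
      (continuousOn_segment hseg (differentiableOn_gegenLift hU l t hr)) P

end Analytic

/-! ### Decay of the moments of analytic functions -/

/-- The two-term recurrence for the moments of `1`: integrate the derivative of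
`(1 - x²)^(2l) R_n` and express both terms through `R_{n+1}` and `R_{n-1}`. -/
theorem ultraInner_one_gegen_rec {l : ℝ} (hl : 1 / 2 ≤ l) (n : ℕ) :
    (n + 2 * l) * (n + 4 * l) * ultraInner (2 * l - 1) 1 (gegen l (n + 1)) =
      n * (n - 2 * l) * ultraInner (2 * l - 1) 1 (gegen l (n - 1)) := by
  have hl0 : 0 < l := by linarith
  have he : 0 ≤ 2 * l - 1 := by linarith
  have h := integral_weighted_derivative (E := ℝ) he
    (V := fun x => (gegen l n).eval x) (V' := fun x => (derivative (gegen l n)).eval x)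
    (fun x _ => Polynomial.hasDerivAt _ x) (Polynomial.continuous _).continuousOn
  have key : ultraInner (2 * l - 1)
      (C ((n + 2 * l) * (n + 4 * l)) * gegen l (n + 1) -
        C (n * (n - 2 * l)) * gegen l (n - 1)) 1 = 0 := by
    rw [← mul_zero (-(2 * ((n : ℝ) + l))), ← h, ultraInner,
      ← intervalIntegral.integral_const_mul]
    congr 1
    ext x
    have h1 := (gegen_derivative hl0 n x).1
    have h2 := gegen_X_mul hl0 n x
    simp only [eval_sub, eval_mul, eval_C, eval_one, smul_eq_mul]
    linear_combination ((1 - x ^ 2) ^ (2 * l - 1)) * (2 * (n + l) * h1 +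
      (n + 2 * l - 4 * l) * h2)
  rw [ultraInner_sub_left he, ultraInner_C_mul_left, ultraInner_C_mul_left, sub_eq_zero,
    ultraInner_comm, ultraInner_comm _ (gegen l (n - 1))] at key
  exact key

theorem ultraInner_one_gegen_odd {l : ℝ} (hl : 1 / 2 ≤ l) (j : ℕ) :
    ultraInner (2 * l - 1) 1 (gegen l (2 * j + 1)) = 0 := by
  have hne : ∀ n : ℕ, ((n : ℝ) + 2 * l) * (n + 4 * l) ≠ 0 := fun n => by positivity
  induction j with
  | zero =>
    have h := ultraInner_one_gegen_rec hl 0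
    rw [Nat.cast_zero, zero_mul, zero_mul, mul_eq_zero] at h
    exact h.resolve_left (by simpa using hne 0)
  | succ j ih =>
    have h := ultraInner_one_gegen_rec hl (2 * j + 2)
    rw [show 2 * j + 2 - 1 = 2 * j + 1 by omega, ih, mul_zero, mul_eq_zero] at h
    exact h.resolve_left (hne _)

theorem rpow_neg_le_of_le_two_mul {a b s : ℝ} (ha : 0 < a) (hab : a ≤ 2 * b) (hs : 0 ≤ s) :
    b ^ (-s) ≤ 2 ^ s * a ^ (-s) := by
  have hb : 0 < b := by linarith
  have h2 := Real.rpow_le_rpow_of_nonpos ha hab (by linarith : -s ≤ 0)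
  rw [Real.mul_rpow (by norm_num) hb.le] at h2
  calc b ^ (-s) = 2 ^ s * (2 ^ (-s) * b ^ (-s)) := by
        rw [← mul_assoc, ← Real.rpow_add (by norm_num), add_neg_cancel, Real.rpow_zero, one_mul]
    _ ≤ _ := mul_le_mul_of_nonneg_left h2 (by positivity)

/-- The quotient of consecutive even moments of `1` is `1 - 4l / j + O(1 / j²)`, and the odd ones
vanish. -/
theorem abs_ultraInner_one_gegen_le {l : ℝ} (hl : 1 / 2 ≤ l) :
    ∃ K, 0 ≤ K ∧ ∀ n : ℕ,
      |ultraInner (2 * l - 1) 1 (gegen l n)| ≤ K * ((n : ℝ) + 1) ^ (-(4 * l)) := by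
  have hl0 : 0 < l := by linarith
  obtain ⟨K, hK, h⟩ := exists_le_mul_rpow_of_ratio_le
    (u := fun j => |ultraInner (2 * l - 1) 1 (gegen l (2 * j))|) (c := -(4 * l))
    (C := 16 * l ^ 2 + 4 * l) (fun _ => abs_nonneg _) (by positivity) (fun j => by
      have hr := ultraInner_one_gegen_rec hl (2 * j + 1)
      rw [Nat.add_sub_cancel] at hr
      push_cast at hr
      have hj : (0 : ℝ) ≤ j := j.cast_nonneg
      have hd : 0 < (2 * (j : ℝ) + 1 + 2 * l) * (2 * j + 1 + 4 * l) := by positivity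
      rw [mul_add 2 j 1, mul_one, ← mul_le_mul_iff_right₀ hd]
      have ha := congrArg abs hr
      rw [abs_mul, abs_of_pos hd, abs_mul] at ha
      suffices hmain : |(2 * (j : ℝ) + 1) * (2 * j + 1 - 2 * l)| ≤
          (2 * j + 1 + 2 * l) * (2 * j + 1 + 4 * l) *
            (1 + -(4 * l) / (j + 1) + (16 * l ^ 2 + 4 * l) / (j + 1) ^ 2) from
        ha.trans_le ((mul_le_mul_of_nonneg_right hmain (abs_nonneg _)).trans_eq (by ring))
      have hn : (0 : ℝ) < j + 1 := by positivity
      have e : (1 + -(4 * l) / ((j : ℝ) + 1) + (16 * l ^ 2 + 4 * l) / (j + 1) ^ 2) =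
          ((j + 1) ^ 2 - 4 * l * (j + 1) + (16 * l ^ 2 + 4 * l)) / (j + 1) ^ 2 := by
        field_simp
        ring
      rw [e, mul_div_assoc', le_div_iff₀ (by positivity), abs_mul,
        abs_of_nonneg (by positivity : (0 : ℝ) ≤ 2 * j + 1)]
      obtain ⟨w, hw⟩ : ∃ w : ℝ, w = 2 * j + 1 := ⟨_, rfl⟩
      have hw0 : 0 ≤ w := by rw [hw]; positivity
      obtain ⟨v, hv⟩ : ∃ v : ℝ, v = j + 1 := ⟨_, rfl⟩
      have hwv : w = 2 * v - 1 := by rw [hw, hv]; ring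
      rw [← hw, ← hv]
      have hD : 0 ≤ (w + 2 * l) * (w + 4 * l) := by positivity
      -- For `w ≥ 2l` the difference is a polynomial in `w`, `l` with positive coefficients; for
      -- `w < 2l` the constant `16l² + 4l` alone keeps the quadratic in `v` above `v² / 2`.
      rcases abs_cases (w - 2 * l) with ⟨h, _⟩ | ⟨h, _⟩
      · rw [h, ← sub_nonneg]
        have hvw : v = (w + 1) / 2 := by linarith
        rw [hvw]
        ring_nf
        positivity
      · rw [h]
        have h1 : v ^ 2 / 2 ≤ v ^ 2 - 4 * l * v + (16 * l ^ 2 + 4 * l) := by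
          nlinarith [sq_nonneg (v - 4 * l)]
        have h2 : w * -(w - 2 * l) ≤ (w + 2 * l) * (w + 4 * l) / 2 := by nlinarith
        have h3 := mul_le_mul_of_nonneg_left h1 hD
        have h4 := mul_le_mul_of_nonneg_right h2 (sq_nonneg v)
        linarith)
  refine ⟨K * 2 ^ (4 * l), by positivity, fun n => ?_⟩
  rcases Nat.even_or_odd' n with ⟨j, rfl | rfl⟩
  · refine (h j).trans ?_
    rw [mul_assoc]
    refine mul_le_mul_of_nonneg_left ?_ hK
    refine rpow_neg_le_of_le_two_mul (by positivity) ?_ (by positivity)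
    push_cast
    linarith
  · rw [ultraInner_one_gegen_odd hl, abs_zero]
    positivity

/-- The property that the moments of `q` with respect to the weight `(1 - x²)^(2l - 1)` satisfy
`∫ (1 - x²)^(2l - 1) q R_n = O(n^(-4l))`. -/
def HasMomentDecay (l : ℝ) (q : ℂ → ℂ) : Prop :=
  ContinuousOn (fun x : ℝ => q x) (Set.Icc (-1) 1) ∧
    ∃ K, 0 ≤ K ∧ ∀ n : ℕ, ‖ultraMoment (2 * l - 1) q (gegen l n)‖ ≤ K * ((n : ℝ) + 1) ^ (-(4 * l))

theorem hasMomentDecay_one {l : ℝ} (hl : 1 / 2 ≤ l) : HasMomentDecay l fun _ => 1 := by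
  refine ⟨continuousOn_const, ?_⟩
  obtain ⟨K, hK, h⟩ := abs_ultraInner_one_gegen_le hl
  refine ⟨K, hK, fun n => ?_⟩
  convert h n using 1
  rw [← Real.norm_eq_abs, ← Complex.norm_real, ultraInner, ultraMoment,
    ← intervalIntegral.integral_ofReal]
  congr 2
  ext x
  rw [eval_one, one_mul, one_mul, Complex.real_smul, Complex.ofReal_mul]

theorem HasMomentDecay.add {l : ℝ} (hl : 1 / 2 ≤ l) {q r : ℂ → ℂ} (hq : HasMomentDecay l q)
    (hr : HasMomentDecay l r) : HasMomentDecay l fun z => q z + r z := by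
  obtain ⟨cq, K, hK, h⟩ := hq
  obtain ⟨cr, K', hK', h'⟩ := hr
  refine ⟨cq.add cr, K + K', by positivity, fun n => ?_⟩
  rw [ultraMoment_add (by linarith) cq cr, add_mul]
  exact (norm_add_le _ _).trans (add_le_add (h n) (h' n))

theorem HasMomentDecay.const_mul {l : ℝ} {q : ℂ → ℂ} (hq : HasMomentDecay l q) (c : ℂ) :
    HasMomentDecay l fun z => c * q z := by
  obtain ⟨cq, K, hK, h⟩ := hq
  refine ⟨continuousOn_const.mul cq, ‖c‖ * K, by positivity, fun n => ?_⟩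
  rw [ultraMoment_const_mul, norm_mul, mul_assoc]
  exact mul_le_mul_of_nonneg_left (h n) (norm_nonneg c)

theorem HasMomentDecay.id_mul {l : ℝ} (hl : 1 / 2 ≤ l) {q : ℂ → ℂ} (hq : HasMomentDecay l q) :
    HasMomentDecay l fun z => z * q z := by
  obtain ⟨cq, K, hK, h⟩ := hq
  have hl0 : 0 < l := by linarith
  refine ⟨Complex.continuous_ofReal.continuousOn.mul cq, K * 2 ^ (4 * l), by positivity,
    fun n => ?_⟩
  have hn : (0 : ℝ) ≤ n := n.cast_nonneg
  have hden : (0 : ℝ) < 2 * (n + l) := by positivity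
  -- `x R_n` is a convex combination of `R_{n+1}` and `R_{n-1}`
  have e : ultraMoment (2 * l - 1) (fun z => z * q z) (gegen l n) =
      (((n + 2 * l) / (2 * (n + l)) : ℝ) : ℂ) * ultraMoment (2 * l - 1) q (gegen l (n + 1)) +
        ((n / (2 * (n + l)) : ℝ) : ℂ) * ultraMoment (2 * l - 1) q (gegen l (n - 1)) := by
    have hs := ultraMoment_sum (e := 2 * l - 1) (by linarith) cq Finset.univ
      ![(n + 2 * l) / (2 * (n + l)), n / (2 * (n + l))] ![gegen l (n + 1), gegen l (n - 1)]
    simp only [Fin.sum_univ_two, Matrix.cons_val_zero, Matrix.cons_val_one] at hs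
    rw [← hs]
    refine ultraMoment_congr fun x _ => ?_
    have hx : x * (gegen l n).eval x = (n + 2 * l) / (2 * (n + l)) * (gegen l (n + 1)).eval x +
        n / (2 * (n + l)) * (gegen l (n - 1)).eval x := by
      have := gegen_X_mul hl0 n x
      field_simp
      linear_combination this
    rw [eval_add, eval_mul, eval_mul, eval_C, eval_C, ← hx, Complex.ofReal_mul]
    ring
  have hdouble : ∀ k : ℕ, n ≤ 2 * k + 1 →
      ‖ultraMoment (2 * l - 1) q (gegen l k)‖ ≤ K * 2 ^ (4 * l) * ((n : ℝ) + 1) ^ (-(4 * l)) := by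
    intro k hk
    refine (h k).trans ?_
    rw [mul_assoc]
    refine mul_le_mul_of_nonneg_left ?_ hK
    have hk' : (n : ℝ) + 1 ≤ 2 * (k + 1) := by exact_mod_cast (by omega : n + 1 ≤ 2 * (k + 1))
    exact rpow_neg_le_of_le_two_mul (by positivity) hk' (by positivity)
  rw [e]
  refine (norm_add_le _ _).trans ?_
  rw [norm_mul, norm_mul, Complex.norm_real, Complex.norm_real, Real.norm_eq_abs,
    Real.norm_eq_abs, abs_of_nonneg (by positivity), abs_of_nonneg (by positivity)]
  set B := K * 2 ^ (4 * l) * ((n : ℝ) + 1) ^ (-(4 * l))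
  calc _ ≤ (n + 2 * l) / (2 * (n + l)) * B + n / (2 * (n + l)) * B := by
        gcongr
        · exact hdouble _ (by omega)
        · exact hdouble _ (by omega)
    _ = B := by field_simp; ring

theorem HasMomentDecay.one_sub_sq_mul {l : ℝ} (hl : 1 / 2 ≤ l) {q : ℂ → ℂ}
    (hq : HasMomentDecay l q) : HasMomentDecay l fun z => (1 - z ^ 2) * q z := by
  convert hq.add hl (((hq.id_mul hl).id_mul hl).const_mul (-1)) using 2
  ring

section Analytic

variable {U : Set ℂ}

/-- If `q` vanishes to third order at `±1`, three applications of the differential equation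
bound the moments by `O(n⁻⁶)`. -/
theorem hasMomentDecay_cube_mul (hU : IsOpen U)
    (hseg : ∀ x ∈ Set.Icc (-1 : ℝ) 1, (x : ℂ) ∈ U) {l : ℝ} (hl : 1 / 2 ≤ l) (hl' : l ≤ 3 / 2)
    {r : ℂ → ℂ} (hr : DifferentiableOn ℂ r U) :
    HasMomentDecay l fun z => (1 - z ^ 2) ^ 3 * r z := by
  have hl0 : 0 < l := by linarith
  have hr1 := differentiableOn_gegenLift hU l (l + 5 / 2) hr
  have hr2 := differentiableOn_gegenLift hU l (l + 3 / 2) hr1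
  have hr3 := differentiableOn_gegenLift hU l (l + 1 / 2) hr2
  set r1 := gegenLift l (l + 5 / 2) r
  set r2 := gegenLift l (l + 3 / 2) r1
  set r3 := gegenLift l (l + 1 / 2) r2
  have hc : ContinuousOn (fun x : ℝ => (1 - (x : ℂ) ^ 2) ^ 3 * r x) (Set.Icc (-1) 1) := by
    refine ContinuousOn.mul ?_ (continuousOn_segment hseg hr)
    exact ((continuous_const.sub (Complex.continuous_ofReal.pow 2)).pow 3).continuousOn
  obtain ⟨K0, hK0, h0⟩ := norm_ultraMoment_gegen_le hl (e := 2 * l - 1) (by linarith)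
    (q := fun z => (1 - z ^ 2) ^ 3 * r z) hc
  obtain ⟨K, hK, h⟩ := norm_ultraMoment_gegen_le hl (e := 2 * l - 1) (by linarith)
    (continuousOn_segment hseg hr3)
  refine ⟨hc, K0 + K * 2 ^ 6, by positivity, fun n => ?_⟩
  rcases n.eq_zero_or_pos with rfl | hn
  · have := h0 0
    simp only [Nat.cast_zero, zero_add, Real.one_rpow]
    nlinarith
  have e1 := ultraMoment_gegenLift hU hseg hl0 (by linarith : 0 ≤ 2 * l + 1)
    (by ring : 2 * l + 1 = l + (l + 5 / 2) - 3 / 2) hr n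
  have e2 := ultraMoment_gegenLift hU hseg hl0 (by linarith : 0 ≤ 2 * l)
    (by ring : 2 * l = l + (l + 3 / 2) - 3 / 2) hr1 n
  have e3 := ultraMoment_gegenLift hU hseg hl0 (by linarith : 0 ≤ 2 * l - 1)
    (by ring : 2 * l - 1 = l + (l + 1 / 2) - 3 / 2) hr2 n
  rw [sub_add_cancel] at e3
  have e0 : ultraMoment (2 * l - 1) (fun z => (1 - z ^ 2) ^ 3 * r z) (gegen l n) =
      ultraMoment (2 * l + 1 + 1) r (gegen l n) := by
    refine intervalIntegral.integral_congr fun x hx => ?_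
    rw [Set.uIcc_of_le (by norm_num)] at hx
    have h0 : 0 ≤ 1 - x ^ 2 := by nlinarith [hx.1, hx.2]
    have hpow : (1 - x ^ 2) ^ (2 * l + 1 + 1) =
        (1 - x ^ 2) ^ (2 * l - 1) * (1 - x ^ 2) ^ 3 := by
      rw [← Real.rpow_natCast (1 - x ^ 2) 3, ← Real.rpow_add_of_nonneg h0 (by linarith)
        (by norm_num)]
      congr 1
      norm_num
      ring
    simp only [hpow, Complex.real_smul]
    push_cast
    ring
  have hn1 : (1 : ℝ) ≤ n := by exact_mod_cast hn
  have e : ((n * (n + 2 * l) : ℝ) ^ 3 : ℝ) *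
      ‖ultraMoment (2 * l - 1) (fun z => (1 - z ^ 2) ^ 3 * r z) (gegen l n)‖ ≤ K := by
    have : (((n * (n + 2 * l) : ℝ) ^ 3 : ℝ) : ℂ) *
        ultraMoment (2 * l - 1) (fun z => (1 - z ^ 2) ^ 3 * r z) (gegen l n) =
        ultraMoment (2 * l - 1) r3 (gegen l n) := by
      rw [e0, ← e3, ← e2, ← e1]
      push_cast
      ring
    rw [← abs_of_nonneg (by positivity : (0 : ℝ) ≤ (n * (n + 2 * l) : ℝ) ^ 3),
      ← Real.norm_eq_abs, ← Complex.norm_real, ← norm_mul, this]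
    exact h n
  set y := ‖ultraMoment (2 * l - 1) (fun z => (1 - z ^ 2) ^ 3 * r z) (gegen l n)‖
  have hy : 0 ≤ y := norm_nonneg _
  have hsix : ((n : ℝ) + 1) ^ (-(4 * l)) ≥ (((n : ℝ) + 1) ^ 6)⁻¹ := by
    rw [← Real.rpow_natCast, ← Real.rpow_neg (by positivity)]
    refine Real.rpow_le_rpow_of_exponent_le (by linarith) ?_
    push_cast
    linarith
  have h4 : ((n : ℝ) + 1) ^ 6 * y ≤ K * 2 ^ 6 := by
    have hb : (n : ℝ) + 1 ≤ 2 * n := by linarith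
    have hb2 : ((n : ℝ) + 1) ^ 6 ≤ (2 * n) ^ 6 := by gcongr
    have hb3 : (n : ℝ) ^ 6 ≤ (n * (n + 2 * l) : ℝ) ^ 3 := by
      rw [show (n : ℝ) ^ 6 = (n * n : ℝ) ^ 3 by ring]
      gcongr
      linarith
    calc ((n : ℝ) + 1) ^ 6 * y ≤ 2 ^ 6 * ((n * (n + 2 * l) : ℝ) ^ 3 * y) := by
          rw [← mul_assoc]
          refine mul_le_mul_of_nonneg_right ?_ hy
          rw [mul_pow] at hb2
          linarith
      _ ≤ 2 ^ 6 * K := by gcongr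
      _ = _ := mul_comm _ _
  have h5 : y ≤ K * 2 ^ 6 * (((n : ℝ) + 1) ^ 6)⁻¹ := by
    rw [← div_eq_mul_inv, le_div_iff₀ (by positivity)]
    linarith
  calc y ≤ K * 2 ^ 6 * (((n : ℝ) + 1) ^ 6)⁻¹ := h5
    _ ≤ (K0 + K * 2 ^ 6) * ((n : ℝ) + 1) ^ (-(4 * l)) := by
      gcongr
      linarith

/-- Division with remainder by `1 - z²` for functions analytic near `±1`. -/
theorem exists_eq_add_one_sub_sq_mul (hU : IsOpen U) (h1 : (1 : ℂ) ∈ U) (h2 : (-1 : ℂ) ∈ U)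
    {q : ℂ → ℂ} (hq : DifferentiableOn ℂ q U) :
    ∃ (a b : ℂ) (r : ℂ → ℂ), DifferentiableOn ℂ r U ∧
      ∀ z, q z = a * 1 + b * (z * 1) + (1 - z ^ 2) * r z := by
  have hd1 := (Complex.differentiableOn_dslope (hU.mem_nhds h1)).2 hq
  have hd2 := (Complex.differentiableOn_dslope (hU.mem_nhds h2)).2 hd1
  refine ⟨q 1 - dslope q 1 (-1), dslope q 1 (-1), fun z => -dslope (dslope q 1) (-1) z,
    hd2.neg, fun z => ?_⟩
  have e1 := sub_smul_dslope q 1 z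
  have e2 := sub_smul_dslope (dslope q 1) (-1) z
  simp only [smul_eq_mul] at e1 e2
  linear_combination -e1 - (z - 1) * e2

theorem hasMomentDecay_of_differentiableOn (hU : IsOpen U)
    (hseg : ∀ x ∈ Set.Icc (-1 : ℝ) 1, (x : ℂ) ∈ U) {l : ℝ} (hl : 1 / 2 ≤ l) (hl' : l ≤ 3 / 2)
    {q : ℂ → ℂ} (hq : DifferentiableOn ℂ q U) : HasMomentDecay l q := by
  have h1 : (1 : ℂ) ∈ U := by simpa using hseg 1 (by norm_num)
  have h2 : (-1 : ℂ) ∈ U := by simpa using hseg (-1) (by norm_num)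
  have hone := hasMomentDecay_one hl
  suffices H : ∀ k ≤ 3, ∀ r : ℂ → ℂ, DifferentiableOn ℂ r U →
      HasMomentDecay l fun z => (1 - z ^ 2) ^ (3 - k) * r z by
    simpa using H 3 le_rfl q hq
  intro k
  induction k with
  | zero => exact fun _ r hr => hasMomentDecay_cube_mul hU hseg hl hl' hr
  | succ k ih =>
    intro hk r hr
    obtain ⟨a, b, s, hs, he⟩ := exists_eq_add_one_sub_sq_mul hU h1 h2 hr
    have hpoly : ∀ j : ℕ, HasMomentDecay l fun z => (1 - z ^ 2) ^ j * (a * 1 + b * (z * 1)) := by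
      intro j
      induction j with
      | zero =>
        simpa using (hone.const_mul a).add hl ((hone.id_mul hl).const_mul b)
      | succ j ihj =>
        convert ihj.one_sub_sq_mul hl using 2
        ring
    convert (hpoly (3 - (k + 1))).add hl (ih (by omega) s hs) using 2 with z
    rw [he z, show 3 - k = 3 - (k + 1) + 1 by omega]
    ring

end Analytic

/-! ### Summation of the linearization coefficients -/

theorem half_mul_sub_le_rpow_sub {l a b : ℝ} (hl : 1 / 2 ≤ l) (ha : 0 ≤ a) (hab : a ≤ b)
    (hb : 0 < b) : 1 / 2 * (b ^ (l - 1) * (b - a)) ≤ b ^ l - a ^ l := by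
  obtain ⟨t, rfl⟩ : ∃ t, a = b * t := ⟨a / b, by field_simp⟩
  have ht0 : 0 ≤ t := nonneg_of_mul_nonneg_right ha hb
  have ht1 : t ≤ 1 := by nlinarith
  -- For `t ≤ 1` the exponent `1 / 2` is the worst case, and there Bernoulli's inequality applies.
  have h1 : t ^ l ≤ t ^ (1 / 2 : ℝ) :=
    Real.rpow_le_rpow_of_exponent_ge' ht0 ht1 (by norm_num) hl
  have h2 : (1 + (t - 1)) ^ (1 / 2 : ℝ) ≤ 1 + 1 / 2 * (t - 1) :=
    rpow_one_add_le_one_add_mul_self (by linarith) (by norm_num) (by norm_num)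
  rw [add_sub_cancel] at h2
  have hbl : 0 ≤ b ^ l := Real.rpow_nonneg hb.le _
  have e : b ^ (l - 1) * (b - b * t) = b ^ l * (1 - t) := by
    rw [Real.rpow_sub_one hb.ne']
    field_simp
  rw [e, Real.mul_rpow hb.le ht0]
  nlinarith

/-- Comparison with the telescoping sum of the differences of `(i / (i + d))^l`. -/
theorem sum_rpow_mul_rpow_le {l d : ℝ} (hl : 1 / 2 ≤ l) (hd : 0 < d) (M : ℕ) :
    ∑ i ∈ Finset.range M, ((i : ℝ) + 1) ^ (l - 1) * ((i : ℝ) + 1 + d) ^ (-l - 1) ≤ 2 / d := by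
  have hstep : ∀ i : ℕ, ((i : ℝ) + 1) ^ (l - 1) * ((i : ℝ) + 1 + d) ^ (-l - 1) ≤
      2 / d * (((i + 1 : ℕ) / ((i + 1 : ℕ) + d)) ^ l - ((i : ℝ) / (i + d)) ^ l) := by
    intro i
    have hi : (0 : ℝ) ≤ i := i.cast_nonneg
    have hid : 0 < (i : ℝ) + d := by positivity
    have hid' : 0 < (i : ℝ) + 1 + d := by positivity
    push_cast
    have hdiff : ((i : ℝ) + 1) / (i + 1 + d) - i / (i + d) = d / ((i + d) * (i + 1 + d)) := by
      field_simp
      ring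
    have hle : d / ((i : ℝ) + 1 + d) ^ 2 ≤ ((i : ℝ) + 1) / (i + 1 + d) - i / (i + d) := by
      rw [hdiff]
      refine div_le_div_of_nonneg_left hd.le (by positivity) ?_
      nlinarith
    have hd2 : 0 ≤ d / ((i : ℝ) + 1 + d) ^ 2 := by positivity
    have h := half_mul_sub_le_rpow_sub (l := l) (a := (i : ℝ) / (i + d))
      (b := ((i : ℝ) + 1) / (i + 1 + d)) hl (by positivity) (by linarith) (by positivity)
    have h2 := mul_le_mul_of_nonneg_left hle
      (Real.rpow_nonneg (by positivity : 0 ≤ ((i : ℝ) + 1) / (i + 1 + d)) (l - 1))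
    have e : ((i : ℝ) + 1) ^ (l - 1) * ((i : ℝ) + 1 + d) ^ (-l - 1) * d =
        (((i : ℝ) + 1) / (i + 1 + d)) ^ (l - 1) * (d / ((i : ℝ) + 1 + d) ^ 2) := by
      rw [Real.div_rpow (by positivity) hid'.le, show -l - 1 = -(l - 1) - 2 by ring,
        Real.rpow_sub hid', Real.rpow_neg hid'.le, Real.rpow_two]
      field_simp
    rw [div_mul_eq_mul_div, le_div_iff₀ hd, e]
    linarith
  refine (Finset.sum_le_sum fun i _ => hstep i).trans ?_
  rw [← Finset.mul_sum, Finset.sum_range_sub (fun i : ℕ => ((i : ℝ) / (i + d)) ^ l)]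
  have hM : ((M : ℝ) / (M + d)) ^ l ≤ 1 := by
    refine Real.rpow_le_one (by positivity) ?_ (by linarith)
    rw [div_le_one (by positivity)]
    linarith
  have h0 : (((0 : ℕ) : ℝ) / ((0 : ℕ) + d)) ^ l = 0 := by
    simp [Real.zero_rpow (by linarith : l ≠ 0)]
  rw [h0, sub_zero]
  exact mul_le_of_le_one_right (by positivity) hM

theorem rpow_le_three_rpow_abs_mul {x N : ℝ} (s : ℝ) (hN : 0 < N) (h1 : N / 3 ≤ x)
    (h2 : x ≤ 3 * N) : x ^ s ≤ 3 ^ |s| * N ^ s := by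
  rcases le_total 0 s with hs | hs
  · rw [abs_of_nonneg hs, ← Real.mul_rpow (by norm_num) hN.le]
    exact Real.rpow_le_rpow (by linarith [div_pos hN three_pos]) h2 hs
  · rw [abs_of_nonpos hs]
    refine (Real.rpow_le_rpow_of_nonpos (by positivity) h1 hs).trans_eq ?_
    rw [Real.div_rpow hN.le (by norm_num), Real.rpow_neg (by norm_num)]
    field_simp

/-- For a low index `k = 2 * i + d ≤ (m + n) / 3`, the linearization coefficient of `R_k` in
`R_m R_n`, where `m = i + j` and `n = i + d + j`, is much smaller than the trivial bound `1`. -/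
theorem dougall_le {l : ℝ} (hl : 1 / 2 ≤ l) (hl' : l ≤ 3 / 2) :
    ∃ K, 0 ≤ K ∧ ∀ i j d : ℕ, 1 ≤ d → (2 * i + d : ℝ) ≤ (2 * i + 2 * j + d) / 3 →
      dougall l i (i + d) j ≤ K * ((2 * i + 2 * j + d : ℝ) ^ (-(2 * l)) *
        (((i : ℝ) + 1) ^ (l - 1) * ((i : ℝ) + 1 + d) ^ l)) := by
  have hl0 : 0 < l := by linarith
  obtain ⟨A, hA, ha⟩ := pochQuot_le hl0
  obtain ⟨B, hB, hb⟩ := pochQuot_div_le hl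
  obtain ⟨D, hD, hc⟩ := inv_pochQuot_le (by linarith : 1 ≤ 2 * l)
  refine ⟨6 * (A * A * (A * 3 ^ |l - 1|)) * (B * 3 ^ |l|) *
    ((D * 3 ^ |1 - 2 * l|) * (D * 3 ^ |1 - 2 * l|)), by positivity, fun i j d hd hk => ?_⟩
  have hd1 : (1 : ℝ) ≤ d := by exact_mod_cast hd
  have hi : (0 : ℝ) ≤ i := i.cast_nonneg
  have hj : (0 : ℝ) ≤ j := j.cast_nonneg
  set N : ℝ := 2 * i + 2 * j + d with hN
  have hNpos : 0 < N := by positivity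
  have hp := fun n => (pochQuot_pos hl0 n).le
  have hq := fun n => pochQuot_pos (by linarith : 0 < 2 * l) n
  have b1 : ((i : ℝ) + (i + d : ℕ) + l) / (i + (i + d : ℕ) + j + l) ≤ 6 * (i + 1 + d) / N := by
    push_cast
    rw [div_le_div_iff₀ (by positivity) hNpos]
    have h1 : (i : ℝ) + (i + d) + l ≤ 2 * (i + 1 + d) := by linarith
    have h2 : N ≤ 3 * (i + (i + d) + j + l) := by rw [hN]; linarith
    calc ((i : ℝ) + (i + d) + l) * N ≤ 2 * (i + 1 + d) * (3 * (i + (i + d) + j + l)) := by gcongr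
      _ = _ := by ring
  have b2 : pochQuot l i ≤ A * ((i : ℝ) + 1) ^ (l - 1) := ha i
  have b3 : pochQuot l (i + d) ≤ A * ((i : ℝ) + 1 + d) ^ (l - 1) := by
    refine (ha (i + d)).trans_eq ?_
    push_cast
    ring_nf
  have b4 : pochQuot l j ≤ A * 3 ^ |l - 1| * N ^ (l - 1) := by
    refine (ha j).trans ?_
    rw [mul_assoc]
    exact mul_le_mul_of_nonneg_left
      (rpow_le_three_rpow_abs_mul _ hNpos (by linarith) (by linarith)) hA
  have b5 : pochQuot (2 * l) (i + (i + d) + j) / pochQuot l (i + (i + d) + j) ≤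
      B * 3 ^ |l| * N ^ l := by
    refine (hb _).trans ?_
    rw [mul_assoc]
    push_cast
    exact mul_le_mul_of_nonneg_left
      (rpow_le_three_rpow_abs_mul _ hNpos (by linarith) (by linarith)) hB
  have b6 : ∀ p : ℕ, N / 3 ≤ (p : ℝ) + 1 → (p : ℝ) + 1 ≤ 3 * N →
      (pochQuot (2 * l) p)⁻¹ ≤ D * 3 ^ |1 - 2 * l| * N ^ (1 - 2 * l) := by
    intro p h1 h2
    refine (hc _).trans ?_
    rw [mul_assoc]
    exact mul_le_mul_of_nonneg_left (rpow_le_three_rpow_abs_mul _ hNpos h1 h2) hD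
  have b7 := b6 (i + j) (by push_cast; linarith) (by push_cast; linarith)
  have b8 := b6 (i + d + j) (by push_cast; linarith) (by push_cast; linarith)
  have q1 := (hq (i + (i + d) + j)).le
  have q2 := inv_nonneg.2 (hq (i + j)).le
  have q3 := inv_nonneg.2 (hq (i + d + j)).le
  have hid : 0 < (i : ℝ) + 1 + d := by positivity
  have p1 := hp i
  have p2 := hp (i + d)
  have p3 := hp j
  have p4 := div_nonneg q1 (hp (i + (i + d) + j))
  calc dougall l i (i + d) j
      ≤ 6 * (i + 1 + d) / N * (A * ((i : ℝ) + 1) ^ (l - 1) * (A * ((i : ℝ) + 1 + d) ^ (l - 1)) *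
          (A * 3 ^ |l - 1| * N ^ (l - 1))) * (B * 3 ^ |l| * N ^ l) *
        ((D * 3 ^ |1 - 2 * l| * N ^ (1 - 2 * l)) * (D * 3 ^ |1 - 2 * l| * N ^ (1 - 2 * l))) := by
        unfold dougall
        gcongr
    _ = _ := by
        have e1 : ((i : ℝ) + 1 + d) ^ l = (i + 1 + d) ^ (l - 1) * (i + 1 + d) := by
          rw [Real.rpow_sub_one hid.ne']
          field_simp
        have e2 : N ^ (-(2 * l)) =
            N ^ (l - 1) * N ^ l * (N ^ (1 - 2 * l) * N ^ (1 - 2 * l)) / N := by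
          rw [← Real.rpow_add hNpos, ← Real.rpow_add hNpos, ← Real.rpow_add hNpos,
            ← Real.rpow_sub_one hNpos.ne']
          congr 1
          ring
        rw [e1, e2]
        ring

/-- The average of `k^(-4l)` over the linearization of `R_m R_n` is `O((m + n)^(-2l) d^(-2l))`,
where `d = n - m`. Indices `k ≥ (m + n) / 3` are harmless since also `k ≥ d`. -/
theorem sum_linCoeff_mul_rpow_le {l : ℝ} (hl : 1 / 2 ≤ l) (hl' : l ≤ 3 / 2) :
    ∃ K, 0 ≤ K ∧ ∀ m d : ℕ, 1 ≤ d →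
      ∑ j ∈ Finset.range (m + 1), linCoeff l m (m + d) j *
        (((m + (m + d) - 2 * j : ℕ) : ℝ) + 1) ^ (-(4 * l)) ≤
      K * ((m + (m + d : ℕ) : ℝ) ^ (-(2 * l)) * (d : ℝ) ^ (-(2 * l))) := by
  have hl0 : 0 < l := by linarith
  obtain ⟨K, hK, h⟩ := dougall_le hl hl'
  refine ⟨3 ^ (2 * l) + 2 * K, by positivity, fun m d hd => ?_⟩
  have hd1 : (1 : ℝ) ≤ d := by exact_mod_cast hd
  have hd0 : (0 : ℝ) < d := by linarith
  have hm0 : (0 : ℝ) ≤ m := m.cast_nonneg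
  set N : ℝ := m + (m + d : ℕ) with hN
  have hN' : N = 2 * m + d := by rw [hN]; push_cast; ring
  have hNpos : 0 < N := by rw [hN']; positivity
  set f : ℕ → ℝ := fun i => ((i : ℝ) + 1) ^ (l - 1) * ((i : ℝ) + 1 + d) ^ (-l - 1) with hf
  have hterm : ∀ j ∈ Finset.range (m + 1), linCoeff l m (m + d) j *
      (((m + (m + d) - 2 * j : ℕ) : ℝ) + 1) ^ (-(4 * l)) ≤
      linCoeff l m (m + d) j * (3 ^ (2 * l) * (N ^ (-(2 * l)) * (d : ℝ) ^ (-(2 * l)))) +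
        K * (N ^ (-(2 * l)) * (d : ℝ) ^ (1 - 2 * l)) * f (m - j) := by
    intro j hj
    obtain ⟨i, rfl⟩ : ∃ i, m = i + j :=
      ⟨m - j, by have := Finset.mem_range.1 hj; omega⟩
    have hi0 : (0 : ℝ) ≤ i := i.cast_nonneg
    have hj0 : (0 : ℝ) ≤ j := j.cast_nonneg
    have hlc : linCoeff l (i + j) (i + j + d) j = dougall l i (i + d) j := by
      rw [linCoeff, if_pos (by omega), Nat.add_sub_cancel,
        show i + j + d - j = i + d by omega]
    have hg := dougall_nonneg hl0 i (i + d) j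
    rw [hlc, show i + j + (i + j + d) - 2 * j = 2 * i + d by omega, Nat.add_sub_cancel]
    push_cast at hN' ⊢
    have hid : 0 < (i : ℝ) + 1 + d := by positivity
    have hNe : N = 2 * i + 2 * j + d := by rw [hN']; ring
    rcases le_total (N / 3) (2 * i + d) with hk | hk
    · have hk1 : (2 * (i : ℝ) + d + 1) ^ (-(4 * l)) ≤
          3 ^ (2 * l) * (N ^ (-(2 * l)) * (d : ℝ) ^ (-(2 * l))) := by
        rw [show -(4 * l) = -(2 * l) + -(2 * l) by ring, Real.rpow_add (by positivity),
          ← mul_assoc]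
        have e : 3 ^ (2 * l) * N ^ (-(2 * l)) = (N / 3) ^ (-(2 * l)) := by
          rw [Real.div_rpow hNpos.le (by norm_num), Real.rpow_neg (by norm_num : (0 : ℝ) ≤ 3)]
          field_simp
        rw [e]
        gcongr ?_ * ?_
        · exact Real.rpow_le_rpow_of_nonpos (by positivity) (by linarith) (by linarith)
        · exact Real.rpow_le_rpow_of_nonpos (by positivity) (by linarith) (by linarith)
      have hfn : 0 ≤ f i := by simp only [hf]; positivity
      have h2 := mul_le_mul_of_nonneg_left hk1 hg
      have h3 : 0 ≤ K * (N ^ (-(2 * l)) * (d : ℝ) ^ (1 - 2 * l)) * f i := by positivity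
      linarith
    · have h1 := h i j d hd (by rw [← hNe]; exact hk)
      rw [← hNe] at h1
      have h2 : (2 * (i : ℝ) + d + 1) ^ (-(4 * l)) ≤ ((i : ℝ) + 1 + d) ^ (-(4 * l)) :=
        Real.rpow_le_rpow_of_nonpos hid (by linarith) (by linarith)
      have h3 : ((i : ℝ) + 1 + d) ^ (1 - 2 * l) ≤ (d : ℝ) ^ (1 - 2 * l) :=
        Real.rpow_le_rpow_of_nonpos hd0 (by linarith) (by linarith)
      have e : ((i : ℝ) + 1 + d) ^ l * ((i : ℝ) + 1 + d) ^ (-(4 * l)) =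
          ((i : ℝ) + 1 + d) ^ (1 - 2 * l) * ((i : ℝ) + 1 + d) ^ (-l - 1) := by
        rw [← Real.rpow_add hid, ← Real.rpow_add hid]
        congr 1
        ring
      refine le_add_of_nonneg_of_le (by positivity) ?_
      calc dougall l i (i + d) j * (2 * (i : ℝ) + d + 1) ^ (-(4 * l))
          ≤ K * (N ^ (-(2 * l)) * (((i : ℝ) + 1) ^ (l - 1) * ((i : ℝ) + 1 + d) ^ l)) *
              ((i : ℝ) + 1 + d) ^ (-(4 * l)) := by gcongr
        _ = K * (N ^ (-(2 * l)) * ((i : ℝ) + 1 + d) ^ (1 - 2 * l)) * f i := by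
            simp only [hf]
            linear_combination K * N ^ (-(2 * l)) * ((i : ℝ) + 1) ^ (l - 1) * e
        _ ≤ _ := by
            have hfn : 0 ≤ f i := by simp only [hf]; positivity
            gcongr
  refine (Finset.sum_le_sum hterm).trans ?_
  rw [Finset.sum_add_distrib, ← Finset.sum_mul, sum_linCoeff hl0 (by omega), one_mul,
    ← Finset.mul_sum, Finset.sum_flip f]
  have hsum := sum_rpow_mul_rpow_le hl hd0 (m + 1)
  have hlast := mul_le_mul_of_nonneg_left hsum
    (by positivity : 0 ≤ K * (N ^ (-(2 * l)) * (d : ℝ) ^ (1 - 2 * l)))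
  have e : (d : ℝ) ^ (-(2 * l)) = (d : ℝ) ^ (1 - 2 * l) / d := by
    rw [← Real.rpow_sub_one hd0.ne']
    congr 1
    ring
  calc _ ≤ 3 ^ (2 * l) * (N ^ (-(2 * l)) * (d : ℝ) ^ (-(2 * l))) +
        K * (N ^ (-(2 * l)) * (d : ℝ) ^ (1 - 2 * l)) * (2 / d) := by gcongr
    _ = _ := by rw [e]; ring

/-! ### The matrix entries -/

theorem ofReal_mem_bernsteinRegion {ρ : ℝ} (hρ : 1 < ρ) {x : ℝ} (hx : x ∈ Set.Icc (-1 : ℝ) 1) :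
    (x : ℂ) ∈ bernsteinRegion ρ := by
  have hρ0 : 0 < ρ := by linarith
  set c : ℝ := 1 / 2 * (ρ + ρ⁻¹) with hc
  have hc1 : 1 ≤ c := by
    have h : ρ * ρ⁻¹ = 1 := mul_inv_cancel₀ hρ0.ne'
    have : 0 < ρ⁻¹ := by positivity
    nlinarith [sq_nonneg (ρ - ρ⁻¹)]
  have h1 : (c : ℂ) ∈ bernsteinEllipse ρ := by
    refine ⟨0, ⟨le_rfl, by positivity⟩, ?_⟩
    simp [hc]
  have h2 : (-c : ℂ) ∈ bernsteinEllipse ρ := by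
    refine ⟨Real.pi, ⟨Real.pi_pos.le, by linarith [Real.pi_pos]⟩, ?_⟩
    rw [Complex.exp_neg, Complex.exp_pi_mul_I, hc]
    push_cast
    norm_num
    ring
  have hs := (convex_convexHull ℝ (bernsteinEllipse ρ)).segment_subset
    (subset_convexHull ℝ _ h2) (subset_convexHull ℝ _ h1)
  refine hs ⟨(1 - x / c) / 2, (1 + x / c) / 2, ?_, ?_, by ring, ?_⟩
  · have : x / c ≤ 1 := by rw [div_le_one (by linarith)]; linarith [hx.2]
    linarith
  · have : -1 ≤ x / c := by rw [le_div_iff₀ (by linarith)]; linarith [hx.1]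
    linarith
  · have hc0 : (c : ℂ) ≠ 0 := by
      exact_mod_cast (by linarith : c ≠ 0)
    simp only [Complex.real_smul]
    push_cast
    field_simp
    ring

theorem potentialEntry_comm (α : ℝ) (q : ℂ → ℂ) (m n : ℕ) :
    potentialEntry α q m n = potentialEntry α q n m := by
  unfold potentialEntry
  congr 1
  ext x
  ring

/-- Linearization reduces the entry `q_{mn}` to the moments `∫ (1 - x²)^α q R_k`. -/
theorem potentialEntry_eq_sum {l : ℝ} (hl : 1 / 2 ≤ l) {q : ℂ → ℂ}
    (hq : ContinuousOn (fun x : ℝ => q x) (Set.Icc (-1) 1)) {m n : ℕ} (hmn : m ≤ n) :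
    potentialEntry (2 * l - 1) q m n = ∑ j ∈ Finset.range (m + 1),
      (linCoeff l m n j : ℂ) * ultraMoment (2 * l - 1) q (gegen l (m + n - 2 * j)) := by
  rw [← ultraMoment_sum (by linarith) hq, potentialEntry,
    show (2 * l - 1) / 2 = l - 1 / 2 by ring, jacobiP_eq_gegen hl, jacobiP_eq_gegen hl,
    ultraMoment]
  congr 1
  ext x
  simp only [eval_finsetSum, eval_mul, eval_C]
  rw [← gegen_mul_gegen (by linarith) n x m hmn, Complex.real_smul, Complex.ofReal_mul]
  ring

theorem proposition3p3 (α : ℝ) (hα : α ∈ Set.Ioc (0 : ℝ) 2) (ρ : ℝ) (hρ : 1 < ρ) (q : ℂ → ℂ)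
    (hq : AnalyticOnNhd ℂ q (bernsteinRegion ρ)) :
    ∃ (K : ℝ) (N : ℕ), ∀ m n : ℕ, N ≤ m + n → m ≠ n →
      ‖potentialEntry α q m n‖ ≤
        K * (((m : ℝ) + n) ^ (-α - 1) * |(m : ℝ) - n| ^ (-α - 1)) := by
  obtain ⟨l, rfl⟩ : ∃ l, α = 2 * l - 1 := ⟨(α + 1) / 2, by ring⟩
  have hl : 1 / 2 ≤ l := by linarith [hα.1]
  have hl' : l ≤ 3 / 2 := by linarith [hα.2]
  have hl0 : 0 < l := by linarith
  have hdec : HasMomentDecay l q :=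
    hasMomentDecay_of_differentiableOn (U := {z | AnalyticAt ℂ q z}) (isOpen_analyticAt ℂ q)
      (fun x hx => hq x (ofReal_mem_bernsteinRegion hρ hx)) hl hl'
      fun z hz => hz.differentiableAt.differentiableWithinAt
  obtain ⟨hc, K, hK, h⟩ := hdec
  obtain ⟨K', hK', h'⟩ := sum_linCoeff_mul_rpow_le hl hl'
  have main : ∀ m n : ℕ, m < n → ‖potentialEntry (2 * l - 1) q m n‖ ≤
      K * K' * (((m : ℝ) + n) ^ (-(2 * l)) * |(m : ℝ) - n| ^ (-(2 * l))) := by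
    intro m n hmn
    obtain ⟨d, rfl⟩ : ∃ d, n = m + d := ⟨n - m, by omega⟩
    have hd : |(m : ℝ) - (m + d : ℕ)| = d := by
      push_cast
      rw [sub_add_cancel_left, abs_neg, Nat.abs_cast]
    rw [potentialEntry_eq_sum hl hc hmn.le, hd, mul_assoc]
    refine (norm_sum_le _ _).trans ?_
    refine le_trans ?_ (mul_le_mul_of_nonneg_left (h' m d (by omega)) hK)
    rw [Finset.mul_sum]
    refine Finset.sum_le_sum fun j _ => ?_
    have hg := linCoeff_nonneg hl0 m (m + d) j
    rw [norm_mul, Complex.norm_real, Real.norm_eq_abs, abs_of_nonneg hg, mul_left_comm]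
    exact mul_le_mul_of_nonneg_left (h _) hg
  refine ⟨K * K', 0, fun m n _ hmn => ?_⟩
  rw [show -(2 * l - 1) - 1 = -(2 * l) by ring]
  rcases lt_or_gt_of_ne hmn with hlt | hlt
  · exact main m n hlt
  · rw [potentialEntry_comm, add_comm, abs_sub_comm]
    exact main n m hlt
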